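/- Let $\mathcal{G}$ be the universal central extension of the planar Galilean conformal algebra, i.e. the complex Lie algebra with basis $\{L_k, H_k, I_k, J_k, \mathbf{c}_1, \mathbf{c}_2, \mathbf{c}_3 \mid k\in\mathbb{Z}\}$ whose brackets are given, for all $k,l\in\mathbb{Z}$, by $$[L_k,L_l]=(l-k)L_{k+l}+\tfrac{k^3-k}{12}\,\delta_{k+l,0}\,\mathbf{c}_1,\qquad [L_k,H_l]=lH_{k+l}+k^2\delta_{k+l,0}\,\mathbf{c}_2,\qquad [H_k,H_l]=k\,\delta_{k+l,0}\,\mathbf{c}_3,$$ $$[L_k,I_l]=(l-k)I_{k+l},\qquad [L_k,J_l]=(l-k)J_{k+l},\qquad [H_k,I_l]=I_{k+l},\qquad [H_k,J_l]=-J_{k+l},$$ all other brackets of basis elements (apart from those obtained by skew-symmetry) being zero. For nonnegative integers $m,n$ let $\mathcal{G}^{(m,n)}$ be the Lie subalgebra spanned by $L_{m+i}, H_{m+i}, I_{n+i}, J_{n+i}$ ($i\ge 0$) and $\mathbf{c}_1,\mathbf{c}_2,\mathbf{c}_3$. A Whittaker function on $\mathcal{G}^{(m,n)}$ is a Lie algebra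 homomorphism $\psi_{m,n}:\mathcal{G}^{(m,n)}\to\mathbb{C}$. Let $\mathbb{C}w_{\psi_{m,n}}$ be the one-dimensional $\mathcal{G}^{(m,n)}$-module with $x\cdot w_{\psi_{m,n}}=\psi_{m,n}(x)w_{\psi_{m,n}}$, and let $$W_{\psi_{m,n}}=\mathcal{U}(\mathcal{G})\otimes_{\mathcal{U}(\mathcal{G}^{(m,n)})}\mathbb{C}w_{\psi_{m,n}}$$ be the induced $\mathcal{G}$-module (the Whittaker module), where $\mathcal{U}$ denotes the universal enveloping algebra. Theorem. Let $m$ be a positive integer and $n$ a nonnegative integer of the same parity as $m$. Then for every Whittaker function $\psi_{m,n}$ on $\mathcal{G}^{(m,n)}$, the Whittaker module $W_{\psi_{m,n}}$ over $\mathcal{G}$ is irreducible if and only if $$\psi_{m,n}(I_{m+n-1})\,\psi_{m,n}(J_{m+n-1})\neq 0.$$ -/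

import Mathlib

open scoped TensorProduct

/-! ### Modules induced from a Lie subalgebra -/

noncomputable section InducedModules

universe u v w

variable {R : Type u} [CommRing R] {g : Type v} [LieRing g] [LieAlgebra R g]

section

-- Every associative algebra is a Lie algebra under the commutator; this instance is not global.
attribute [local instance 100] LieRing.ofAssociativeRing

/-- The canonical homomorphism `U(h) → U(g)` for a Lie subalgebra `h` of `g`. -/
def LieSubalgebra.envelopingMap (h : LieSubalgebra R g) :
    UniversalEnvelopingAlgebra R h →ₐ[R] UniversalEnvelopingAlgebra R g :=
  UniversalEnvelopingAlgebra.lift R ((UniversalEnvelopingAlgebra.ι R).comp h.incl)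

/-- The action of `U(h)` on an `h`-module `V`. -/
def envelopingAction (R : Type u) [CommRing R] (h : Type v) [LieRing h] [LieAlgebra R h]
    (V : Type w) [AddCommGroup V] [Module R V] [LieRingModule h V] [LieModule R h V] :
    UniversalEnvelopingAlgebra R h →ₐ[R] Module.End R V :=
  UniversalEnvelopingAlgebra.lift R (LieModule.toEnd R h V)

theorem envelopingι_lie (x y : g) :
    UniversalEnvelopingAlgebra.ι R ⁅x, y⁆ =
      UniversalEnvelopingAlgebra.ι R x * UniversalEnvelopingAlgebra.ι R y -
        UniversalEnvelopingAlgebra.ι R y * UniversalEnvelopingAlgebra.ι R x := by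
  rw [LieHom.map_lie, LieRing.of_associative_ring_bracket]

end

/-- The relations `(u a) ⊗ v = u ⊗ (a v)`, for `u ∈ U(g)`, `a ∈ U(h)` and `v ∈ V`, that turn the
tensor product `U(g) ⊗ V` over the ground ring into the tensor product over `U(h)`.
(Mathlib's tensor products are over commutative rings only.) -/
def LieSubalgebra.inducedRelations (h : LieSubalgebra R g) (V : Type w)
    [AddCommGroup V] [Module R V] [LieRingModule h V] [LieModule R h V] :
    Submodule (UniversalEnvelopingAlgebra R g) (UniversalEnvelopingAlgebra R g ⊗[R] V) :=
  Submodule.span (UniversalEnvelopingAlgebra R g)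
    {t | ∃ (u : UniversalEnvelopingAlgebra R g) (a : UniversalEnvelopingAlgebra R h) (v : V),
      t = (u * h.envelopingMap a) ⊗ₜ[R] v - u ⊗ₜ[R] (envelopingAction R h V a v)}

/-- The induced module `Ind_h^g V = U(g) ⊗_{U(h)} V`. -/
abbrev LieSubalgebra.Induced (h : LieSubalgebra R g) (V : Type w)
    [AddCommGroup V] [Module R V] [LieRingModule h V] [LieModule R h V] : Type (max v u w) :=
  (UniversalEnvelopingAlgebra R g ⊗[R] V) ⧸ h.inducedRelations V

/-- `g` acts on `U(g) ⊗_{U(h)} V` by left multiplication on the first factor. -/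
instance LieSubalgebra.Induced.instLieRingModule (h : LieSubalgebra R g) (V : Type w)
    [AddCommGroup V] [Module R V] [LieRingModule h V] [LieModule R h V] :
    LieRingModule g (h.Induced V) where
  bracket x t := UniversalEnvelopingAlgebra.ι R x • t
  add_lie x y t := by
    change UniversalEnvelopingAlgebra.ι R (x + y) • t = _
    rw [map_add, add_smul]
  lie_add x s t := smul_add _ s t
  leibniz_lie x y t := by
    change UniversalEnvelopingAlgebra.ι R x • UniversalEnvelopingAlgebra.ι R y • t =
      UniversalEnvelopingAlgebra.ι R ⁅x, y⁆ • t +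
        UniversalEnvelopingAlgebra.ι R y • UniversalEnvelopingAlgebra.ι R x • t
    rw [envelopingι_lie, sub_smul, mul_smul, mul_smul, sub_add_cancel]

instance LieSubalgebra.Induced.instLieModule (h : LieSubalgebra R g) (V : Type w)
    [AddCommGroup V] [Module R V] [LieRingModule h V] [LieModule R h V] :
    LieModule R g (h.Induced V) where
  smul_lie c x t := by
    change UniversalEnvelopingAlgebra.ι R (c • x) • t = c • UniversalEnvelopingAlgebra.ι R x • t
    rw [map_smul, smul_assoc]
  lie_smul c x t := by
    change UniversalEnvelopingAlgebra.ι R x • c • t = c • UniversalEnvelopingAlgebra.ι R x • t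
    rw [smul_comm]

/-- The rank one module over `h` on which `x` acts as multiplication by `χ x`. -/
def LieAlgebra.LieCharacter.OneDim {h : Type v} [LieRing h] [LieAlgebra R h] (_χ : LieAlgebra.LieCharacter R h) :
    Type u := R

namespace LieAlgebra.LieCharacter.OneDim

variable {h : Type v} [LieRing h] [LieAlgebra R h] (χ : LieAlgebra.LieCharacter R h)

instance instAddCommGroup : AddCommGroup χ.OneDim := inferInstanceAs (AddCommGroup R)

instance instModule : Module R χ.OneDim := inferInstanceAs (Module R R)

instance instLieRingModule : LieRingModule h χ.OneDim where
  bracket x t := χ x • t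
  add_lie x y t := by
    rw [map_add, add_smul]
  lie_add x s t := smul_add (χ x) s t
  leibniz_lie x y t := by
    change χ x • χ y • t = χ ⁅x, y⁆ • t + χ y • χ x • t
    rw [LieAlgebra.lieCharacter_apply_lie, zero_smul, zero_add, smul_comm]

instance instLieModule : LieModule R h χ.OneDim where
  smul_lie c x t := by
    change χ (c • x) • t = c • χ x • t
    rw [map_smul, smul_assoc]
  lie_smul c x t := smul_comm (χ x) c t

end LieAlgebra.LieCharacter.OneDim

end InducedModules

/-! ### The universal central extension of the planar Galilean conformal algebra -/

noncomputable section PlanarGalilean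

/-- Labels of the basis `L_n, H_n, I_n, J_n` (`n ∈ ℤ`), `c₁, c₂, c₃`. -/
inductive PlanarGalilean.Gen : Type
  | L (n : ℤ)
  | H (n : ℤ)
  | I (n : ℤ)
  | J (n : ℤ)
  | c₁
  | c₂
  | c₃

/-- The complex vector space with basis `L_n, H_n, I_n, J_n` (`n ∈ ℤ`), `c₁, c₂, c₃`. -/
def PlanarGalilean : Type := PlanarGalilean.Gen →₀ ℂ

namespace PlanarGalilean

instance instAddCommGroup : AddCommGroup PlanarGalilean :=
  inferInstanceAs (AddCommGroup (Gen →₀ ℂ))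

instance instModule : Module ℂ PlanarGalilean := inferInstanceAs (Module ℂ (Gen →₀ ℂ))

/-- The basis of `𝒢` given by the generators. -/
def basis : Module.Basis Gen ℂ PlanarGalilean := Finsupp.basisSingleOne

/-- The generators `L_n`. -/
def L (n : ℤ) : PlanarGalilean := basis (Gen.L n)
/-- The generators `H_n`. -/
def H (n : ℤ) : PlanarGalilean := basis (Gen.H n)
/-- The generators `I_n`. -/
def I (n : ℤ) : PlanarGalilean := basis (Gen.I n)
/-- The generators `J_n`. -/
def J (n : ℤ) : PlanarGalilean := basis (Gen.J n)
/-- The central generator `c₁`. -/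
def c₁ : PlanarGalilean := basis Gen.c₁
/-- The central generator `c₂`. -/
def c₂ : PlanarGalilean := basis Gen.c₂
/-- The central generator `c₃`. -/
def c₃ : PlanarGalilean := basis Gen.c₃

/-- The Lie bracket on pairs of basis elements; all brackets not listed vanish. -/
def genBracket : Gen → Gen → PlanarGalilean
  | .L m, .L n => ((n : ℂ) - m) • L (m + n) + (if m + n = 0 then ((m : ℂ) ^ 3 - m) / 12 else 0) • c₁
  | .L m, .H n => (n : ℂ) • H (m + n) + (if m + n = 0 then (m : ℂ) ^ 2 else 0) • c₂
  | .H n, .L m => -((n : ℂ) • H (m + n) + (if m + n = 0 then (m : ℂ) ^ 2 else 0) • c₂)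
  | .H m, .H n => (if m + n = 0 then (m : ℂ) else 0) • c₃
  | .L m, .I n => ((n : ℂ) - m) • I (m + n)
  | .I n, .L m => -(((n : ℂ) - m) • I (m + n))
  | .L m, .J n => ((n : ℂ) - m) • J (m + n)
  | .J n, .L m => -(((n : ℂ) - m) • J (m + n))
  | .H m, .I n => I (m + n)
  | .I n, .H m => -I (m + n)
  | .H m, .J n => -J (m + n)
  | .J n, .H m => J (m + n)
  | _, _ => 0

/-- The Lie bracket, extended bilinearly from the basis. -/
def bracketMap : PlanarGalilean →ₗ[ℂ] PlanarGalilean →ₗ[ℂ] PlanarGalilean :=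
  basis.constr ℂ fun i => basis.constr ℂ (genBracket i)

theorem bracketMap_basis (i j : Gen) : bracketMap (basis i) (basis j) = genBracket i j := by
  simp [bracketMap]

theorem genBracket_skew (i j : Gen) : genBracket i j = -genBracket j i := by
  cases i <;> cases j <;> simp only [genBracket, neg_zero, neg_neg]
  case L.L m n =>
    rw [add_comm n m, neg_add, ← neg_smul, ← neg_smul]
    congr 2
    · ring
    · split_ifs with h
      · obtain rfl : n = -m := by omega
        push_cast; ring
      · simp
  case H.H m n =>
    rw [add_comm n m, ← neg_smul]
    congr 1
    split_ifs with h
    · obtain rfl : n = -m := by omega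
      push_cast; ring
    · simp

theorem bracketMap_skew (x y : PlanarGalilean) : bracketMap x y = -bracketMap y x := by
  have : bracketMap = -bracketMap.flip := by
    refine basis.ext fun i => basis.ext fun j => ?_
    simp only [LinearMap.neg_apply, LinearMap.flip_apply, bracketMap_basis]
    exact genBracket_skew i j
  exact congrArg (fun f => f x y) this

theorem genBracket_jacobi (i j k : Gen) :
    bracketMap (basis i) (bracketMap (basis j) (basis k)) =
      bracketMap (bracketMap (basis i) (basis j)) (basis k) +
        bracketMap (basis j) (bracketMap (basis i) (basis k)) := by
  simp only [bracketMap_basis]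
  cases i <;> cases j <;> cases k <;>
    simp only [genBracket, L, H, I, J, c₁, c₂, c₃, map_add, map_neg, map_smul, map_zero,
      LinearMap.add_apply, LinearMap.neg_apply, LinearMap.smul_apply, LinearMap.zero_apply,
      bracketMap_basis, smul_zero, add_zero, zero_add, neg_zero, smul_add, smul_neg, neg_add,
      neg_neg, smul_smul, Int.cast_add]
  all_goals simp only [add_assoc, add_comm (G := ℤ), add_left_comm (G := ℤ)]
  all_goals first
    | module
    | (rename_i a b c
       split_ifs with h
       · obtain rfl : c = -a - b := by omega
         push_cast
         module
       · module)

theorem bracketMap_jacobi (x y z : PlanarGalilean) :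
    bracketMap x (bracketMap y z) =
      bracketMap (bracketMap x y) z + bracketMap y (bracketMap x z) := by
  induction basis.mem_span x using Submodule.span_induction with
  | zero => simp
  | add x x' _ _ hx hx' => simp only [map_add, LinearMap.add_apply, hx, hx']; abel
  | smul c x _ hx => simp only [map_smul, LinearMap.smul_apply, hx, smul_add]
  | mem x hx =>
  obtain ⟨i, rfl⟩ := hx
  induction basis.mem_span y using Submodule.span_induction with
  | zero => simp
  | add y y' _ _ hy hy' => simp only [map_add, LinearMap.add_apply, hy, hy']; abel
  | smul c y _ hy => simp only [map_smul, LinearMap.smul_apply, hy, smul_add]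
  | mem y hy =>
  obtain ⟨j, rfl⟩ := hy
  induction basis.mem_span z using Submodule.span_induction with
  | zero => simp
  | add z z' _ _ hz hz' => simp only [map_add, hz, hz']; abel
  | smul c z _ hz => simp only [map_smul, hz, smul_add]
  | mem z hz =>
  obtain ⟨k, rfl⟩ := hz
  exact genBracket_jacobi i j k

instance instLieRing : LieRing PlanarGalilean where
  bracket x y := bracketMap x y
  add_lie x y z := by
    change bracketMap (x + y) z = bracketMap x z + bracketMap y z
    rw [map_add, LinearMap.add_apply]
  lie_add x y z := map_add (bracketMap x) y z
  lie_self x := by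
    change bracketMap x x = 0
    have h : (2 : ℂ) • bracketMap x x = 0 := by
      rw [two_smul]
      nth_rewrite 1 [bracketMap_skew x x]
      exact neg_add_cancel _
    exact (smul_eq_zero.mp h).resolve_left two_ne_zero
  leibniz_lie := bracketMap_jacobi

/-- The universal central extension `𝒢` of the planar Galilean conformal algebra is
`PlanarGalilean` with this Lie algebra structure. -/
instance instLieAlgebra : LieAlgebra ℂ PlanarGalilean where
  lie_smul c x y := map_smul (bracketMap x) c y

theorem lie_basis (i j : Gen) : ⁅basis i, basis j⁆ = genBracket i j := bracketMap_basis i j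

/-- The basis elements lying in `𝒢^{(m,n)}`: `L_i, H_i` with `i ≥ m`, `I_i, J_i` with `i ≥ n`,
and `c₁, c₂, c₃`. -/
def Gen.Mem (m n : ℕ) : Gen → Prop
  | .L i => (m : ℤ) ≤ i
  | .H i => (m : ℤ) ≤ i
  | .I i => (n : ℤ) ≤ i
  | .J i => (n : ℤ) ≤ i
  | _ => True

theorem genBracket_mem (m n : ℕ) {i j : Gen} (hi : i.Mem m n) (hj : j.Mem m n) :
    genBracket i j ∈ Submodule.span ℂ (basis '' {k | k.Mem m n}) := by
  have key : ∀ k : Gen, k.Mem m n → basis k ∈ Submodule.span ℂ (basis '' {k | k.Mem m n}) :=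
    fun k hk => Submodule.subset_span ⟨k, hk, rfl⟩
  cases i <;> cases j <;> simp only [Gen.Mem] at hi hj <;>
    simp only [genBracket, L, H, I, J, c₁, c₂, c₃, zero_mem] <;>
    (repeat' first | apply add_mem | apply neg_mem | apply Submodule.smul_mem | apply key) <;>
    simp only [Gen.Mem] <;> omega

/-- The subalgebra `𝒢^{(m,n)}`, spanned by `L_{m+i}, H_{m+i}, I_{n+i}, J_{n+i}` (`i ∈ ℕ`) and
`c₁, c₂, c₃`. -/
def subalgebra (m n : ℕ) : LieSubalgebra ℂ PlanarGalilean where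
  toSubmodule := Submodule.span ℂ (basis '' {k | k.Mem m n})
  lie_mem' {x y} hx hy := by
    change x ∈ Submodule.span ℂ _ at hx
    change y ∈ Submodule.span ℂ _ at hy
    change ⁅x, y⁆ ∈ Submodule.span ℂ _
    induction hx, hy using Submodule.span_induction₂ with
    | mem_mem x y hx hy =>
      obtain ⟨i, hi, rfl⟩ := hx
      obtain ⟨j, hj, rfl⟩ := hy
      rw [lie_basis]
      exact genBracket_mem m n hi hj
    | zero_left y _ => rw [zero_lie]; exact zero_mem _
    | zero_right x _ => rw [lie_zero]; exact zero_mem _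
    | add_left x y z _ _ _ h h' => rw [add_lie]; exact add_mem h h'
    | add_right x y z _ _ _ h h' => rw [lie_add]; exact add_mem h h'
    | smul_left c x y _ _ h => rw [smul_lie]; exact Submodule.smul_mem _ c h
    | smul_right c x y _ _ h => rw [lie_smul]; exact Submodule.smul_mem _ c h

theorem basis_mem_subalgebra {m n : ℕ} {k : Gen} (hk : k.Mem m n) : basis k ∈ subalgebra m n :=
  Submodule.subset_span ⟨k, hk, rfl⟩

theorem I_mem_subalgebra {m n : ℕ} {k : ℤ} (hk : (n : ℤ) ≤ k) : I k ∈ subalgebra m n :=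
  basis_mem_subalgebra (k := .I k) hk

theorem J_mem_subalgebra {m n : ℕ} {k : ℤ} (hk : (n : ℤ) ≤ k) : J k ∈ subalgebra m n :=
  basis_mem_subalgebra (k := .J k) hk

/-- A Whittaker function on `𝒢^{(m,n)}`: a Lie algebra homomorphism `𝒢^{(m,n)} → ℂ`. -/
abbrev WhittakerFunction (m n : ℕ) : Type := LieAlgebra.LieCharacter ℂ (subalgebra m n)

/-- The Whittaker module: the `𝒢`-module induced from the one-dimensional
`𝒢^{(m,n)}`-module on which `x` acts as the scalar `ψ x`. -/
abbrev WhittakerModule {m n : ℕ} (ψ : WhittakerFunction m n) : Type :=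
  (subalgebra m n).Induced (LieAlgebra.LieCharacter.OneDim ψ)

end PlanarGalilean

end PlanarGalilean

/-! Write w for the generator and p = m+n-1. Since I_k = [H_m, I_{k-m}] and similarly for J, ψ kills
I_k and J_k for k ≥ m+n, so p is the last index at which ψ can see I or J.

Reducibility: if ψ(I_p) = 0, then I_{n-1} brackets `subalgebra m n` into the kernel of ψ, so ψ
extends to the subalgebra enlarged by I_{n-1}, with an arbitrary value r there. A representation
realizing this character receives a map from the Whittaker module whose kernel is proper and
contains I_{n-1}w - rw. Irreducibility would force I_{n-1}w = rw for both r = 0 and r = 1. The same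
works for J. All that is needed from PBW is that a character of a subalgebra spanned by basis
elements occurs on a nonzero vector of some representation (`exists_representation_of_character`).
This follows from a diamond-lemma argument for the constant term of a normal form; it also gives w ≠
0.

Irreducibility: every vector is a combination of words in L, H applied to words in I, J applied to
w. In a nonzero submodule N, take a vector of minimal degree d > 0 in L, H, with formal derivatives
δ. For i < m, applying I_{p-i} and J_{p-i} minus their scalars lowers the degree, hence gives 0. To
leading order, letters of index > i contribute nothing because ψ vanishes beyond p, and those of
index < i are removed by induction. What remains is ψ(I_p)(tδ_L + δ_H) and ψ(J_p)(tδ_L - δ_H), with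
t = p - 2i odd by the parity assumption. So both derivatives at i have lower degree. Letters of
index ≥ m do not raise degrees, and Euler's identity then lowers the degree of the vector, a
contradiction. The same argument with the roles of (L, H) and (I, J) exchanged brings a vector of N
down to a nonzero multiple of w (`mem_lhFiltration_of_forall`, `mem_ijFiltration_of_forall`). Formal
derivatives are attached to expressions, not to vectors, so no freeness of the module is needed. -/

/-! ### Words and inversions. -/

section OrderedWords

variable {ι : Type*} [LinearOrder ι]

/-- The number of inversions of a word. -/
def List.inversions : List ι → ℕ
  | [] => 0
  | x :: l => l.countP (· < x) + l.inversions

theorem List.inversions_append_swap (u v : List ι) {a b : ι} (h : b < a) :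
    (u ++ b :: a :: v).inversions < (u ++ a :: b :: v).inversions := by
  induction u with
  | nil =>
    simp only [List.nil_append, List.inversions, List.countP_cons, h, not_lt_of_gt h, decide_true,
      decide_false, Bool.false_eq_true, if_true, if_false]
    omega
  | cons x u ih =>
    simp only [List.cons_append, List.inversions, List.countP_append, List.countP_cons]
    omega

/-- A descent of a word. -/
abbrev List.IsDescent (w : List ι) (d : List ι × ι × ι × List ι) : Prop :=
  w = d.1 ++ d.2.1 :: d.2.2.1 :: d.2.2.2 ∧ d.2.2.1 < d.2.1

end OrderedWords

/-! ### The diamond lemma for straightening words in a Lie algebra. -/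

noncomputable section NormalForm

variable {R : Type*} [CommRing R] {g : Type*} [LieRing g] [LieAlgebra R g]
variable {ι : Type*} [LinearOrder ι] (b : Module.Basis ι R g) (T : Set ι) (χ : g →ₗ[R] R)

open Classical in
/-- The constant term of the normal form of a word in the basis `b`: descents are straightened by
means of the Lie bracket, and a letter `a ∈ T` at the end of a word is replaced by `χ (b a)`. -/
def normalFormCoeff (w : List ι) : R :=
  if h : ∃ d, w.IsDescent d then
    normalFormCoeff (h.choose.1 ++ h.choose.2.2.1 :: h.choose.2.1 :: h.choose.2.2.2) +
      b.constr R (fun k => normalFormCoeff (h.choose.1 ++ k :: h.choose.2.2.2))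
        ⁅b h.choose.2.1, b h.choose.2.2.1⁆
  else if h : ∃ p : List ι × ι, w = p.1 ++ [p.2] ∧ p.2 ∈ T then
    χ (b h.choose.2) * normalFormCoeff h.choose.1
  -- A nonempty sorted word whose last letter is outside `T` is a nontrivial normal monomial, so its
  -- constant term is 0.
  else if w = [] then 1 else 0
termination_by (w.length, w.inversions)
decreasing_by
  · have h' := h.choose_spec
    conv_rhs => rw [h'.1]
    rw [Prod.lex_def]
    exact Or.inr ⟨by simp, List.inversions_append_swap _ _ h'.2⟩
  · have h' := h.choose_spec
    conv_rhs => rw [h'.1]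
    rw [Prod.lex_def]
    exact Or.inl (by simp)
  · have h' := h.choose_spec
    conv_rhs => rw [h'.1]
    rw [Prod.lex_def]
    exact Or.inl (by simp)

theorem Module.Basis.constr_constr_comm {ι κ M M' : Type*} [AddCommGroup M] [Module R M]
    [AddCommGroup M'] [Module R M'] (b : Module.Basis ι R M) (b' : Module.Basis κ R M')
    (f : ι → κ → R) (x : M) (y : M') :
    b.constr R (fun i => b'.constr R (f i) y) x =
      b'.constr R (fun j => b.constr R (fun i => f i j) x) y := by
  simp only [Module.Basis.constr_apply, Finsupp.sum, Finset.smul_sum]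
  rw [Finset.sum_comm]
  refine Finset.sum_congr rfl fun _ _ => Finset.sum_congr rfl fun _ _ => ?_
  simp only [smul_eq_mul]; ring

theorem Module.Basis.constr_apply_eq_add {ι M : Type*} [AddCommGroup M] [Module R M]
    (b : Module.Basis ι R M) {f f₁ f₂ : ι → R} (h : ∀ i, f i = f₁ i + f₂ i) (x : M) :
    b.constr R f x = b.constr R f₁ x + b.constr R f₂ x := by
  obtain rfl : f = f₁ + f₂ := funext h
  rw [map_add, LinearMap.add_apply]

/-- The value at `u x v`, for words `u`, `v` and `x ∈ g`. -/
abbrev wordConstr (N : List ι → R) (u v : List ι) : g →ₗ[R] R :=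
  b.constr R fun k => N (u ++ k :: v)

/-- The straightening relation at a descent. -/
abbrev Straightens (N : List ι → R) (u : List ι) (x y : ι) (v : List ι) : Prop :=
  N (u ++ x :: y :: v) = N (u ++ y :: x :: v) + wordConstr b N u v ⁅b x, b y⁆

omit [LinearOrder ι] in
theorem Straightens.symm {N : List ι → R} {u : List ι} {x y : ι} {v : List ι}
    (h : Straightens b N u x y v) : Straightens b N u y x v := by
  unfold Straightens at *
  rw [h, ← lie_skew, map_neg]
  ring

/-- The relation is antisymmetric in the two letters and trivial when they coincide, so descents
suffice. -/
theorem straightens_of_lt {N : List ι → R} {n : ℕ}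
    (h : ∀ u x y v, u.length + v.length + 2 ≤ n → y < x → Straightens b N u x y v)
    (u : List ι) (x y : ι) (v : List ι) (hn : u.length + v.length + 2 ≤ n) :
    Straightens b N u x y v := by
  rcases lt_trichotomy x y with hxy | rfl | hxy
  · exact (h u y x v hn hxy).symm
  · simp [Straightens]
  · exact h u x y v hn hxy

omit [LinearOrder ι] in
theorem wordConstr_cons_sub {N : List ι → R} {n : ℕ}
    (h : ∀ u x y v, u.length + v.length + 2 ≤ n → Straightens b N u x y v)
    (u : List ι) (y : ι) (v : List ι) (hn : u.length + v.length + 2 ≤ n) (x : g) :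
    wordConstr b N u (y :: v) x - wordConstr b N (u ++ [y]) v x = wordConstr b N u v ⁅x, b y⁆ := by
  have : wordConstr b N u (y :: v) - wordConstr b N (u ++ [y]) v =
      wordConstr b N u v ∘ₗ (-(LieAlgebra.ad R g (b y) : g →ₗ[R] g)) := by
    refine b.ext fun i => ?_
    have := h u i y v hn
    unfold Straightens at this
    rw [LinearMap.comp_apply, LinearMap.neg_apply, LieAlgebra.ad_apply, lie_skew,
      LinearMap.sub_apply]
    simp only [Module.Basis.constr_basis, List.append_assoc, List.singleton_append]
    rw [this]; ring
  have := congrArg (fun f => f x) this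
  simpa only [LinearMap.sub_apply, LinearMap.comp_apply, LinearMap.neg_apply, LieAlgebra.ad_apply,
    lie_skew] using this

omit [LinearOrder ι] in
/-- The two ways of straightening disjoint descents agree. -/
theorem straighten_disjoint {N : List ι → R} {u t v : List ι} {x y a c : ι}
    (h : ∀ p z₁ z₂ q, p.length + q.length + 2 ≤ u.length + t.length + v.length + 3 →
      Straightens b N p z₁ z₂ q)
    (h₁ : Straightens b N (u ++ y :: x :: t) a c v)
    (h₂ : Straightens b N u x y (t ++ c :: a :: v)) :
    N (u ++ y :: x :: (t ++ a :: c :: v)) + wordConstr b N u (t ++ a :: c :: v) ⁅b x, b y⁆ =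
      N (u ++ x :: y :: (t ++ c :: a :: v)) +
        b.constr R (fun k => N (u ++ x :: y :: (t ++ k :: v))) ⁅b a, b c⁆ := by
  have e₀ : b.constr R (fun k => N (u ++ x :: y :: (t ++ k :: v))) ⁅b a, b c⁆ =
      wordConstr b N (u ++ x :: y :: t) v ⁅b a, b c⁆ := by
    simp only [wordConstr, List.append_assoc, List.cons_append]
  have e₁ : wordConstr b N u (t ++ a :: c :: v) ⁅b x, b y⁆ =
      wordConstr b N u (t ++ c :: a :: v) ⁅b x, b y⁆ +
        b.constr R (fun k => wordConstr b N (u ++ k :: t) v ⁅b a, b c⁆) ⁅b x, b y⁆ := by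
    refine b.constr_apply_eq_add (fun k => ?_) _
    have := h (u ++ k :: t) a c v (by simp; omega)
    simpa [Straightens] using this
  have e₂ : wordConstr b N (u ++ x :: y :: t) v ⁅b a, b c⁆ =
      wordConstr b N (u ++ y :: x :: t) v ⁅b a, b c⁆ +
        b.constr R (fun k => wordConstr b N u (t ++ k :: v) ⁅b x, b y⁆) ⁅b a, b c⁆ := by
    refine b.constr_apply_eq_add (fun k => ?_) _
    have := h u x y (t ++ k :: v) (by simp; omega)
    simpa [Straightens] using this
  have e₃ : b.constr R (fun k => wordConstr b N (u ++ k :: t) v ⁅b a, b c⁆) ⁅b x, b y⁆ =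
      b.constr R (fun k => wordConstr b N u (t ++ k :: v) ⁅b x, b y⁆) ⁅b a, b c⁆ := by
    unfold wordConstr
    simp only [List.append_assoc, List.cons_append]
    exact Module.Basis.constr_constr_comm b b (fun i j => N (u ++ i :: (t ++ j :: v))) _ _
  have h₁' : N (u ++ y :: x :: (t ++ a :: c :: v)) = N (u ++ y :: x :: (t ++ c :: a :: v)) +
      wordConstr b N (u ++ y :: x :: t) v ⁅b a, b c⁆ := by
    simpa [Straightens] using h₁
  unfold Straightens at h₂
  rw [e₀, e₁, e₂, e₃, h₁', h₂]
  ring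

omit [LinearOrder ι] in
/-- The two ways of straightening overlapping descents agree, by the Jacobi identity. -/
theorem straighten_overlap {N : List ι → R} {u v : List ι} {x y z : ι}
    (h : ∀ p z₁ z₂ q, p.length + q.length + 2 ≤ u.length + v.length + 2 →
      Straightens b N p z₁ z₂ q)
    (h₁ : Straightens b N (u ++ [y]) x z v) (h₂ : Straightens b N u y z (x :: v))
    (h₃ : Straightens b N u x z (y :: v)) (h₄ : Straightens b N (u ++ [z]) x y v) :
    N (u ++ y :: x :: z :: v) + wordConstr b N u (z :: v) ⁅b x, b y⁆ =
      N (u ++ x :: z :: y :: v) + b.constr R (fun k => N (u ++ x :: k :: v)) ⁅b y, b z⁆ := by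
  have e₀ : b.constr R (fun k => N (u ++ x :: k :: v)) ⁅b y, b z⁆ =
      wordConstr b N (u ++ [x]) v ⁅b y, b z⁆ := by
    simp only [wordConstr, List.append_assoc, List.singleton_append]
  have k₁ := wordConstr_cons_sub b h u z v (by omega) ⁅b x, b y⁆
  have k₂ := wordConstr_cons_sub b h u x v (by omega) ⁅b y, b z⁆
  have k₃ := wordConstr_cons_sub b h u y v (by omega) ⁅b x, b z⁆
  have jac : ⁅⁅b x, b y⁆, b z⁆ + ⁅⁅b y, b z⁆, b x⁆ - ⁅⁅b x, b z⁆, b y⁆ = 0 := by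
    rw [lie_lie (b x) (b y), ← lie_skew ⁅b y, b z⁆, ← lie_skew ⁅b x, b z⁆]
    abel
  have jac' := congrArg (wordConstr b N u v) jac
  rw [map_sub, map_add, map_zero] at jac'
  simp only [Straightens, List.append_assoc, List.singleton_append] at h₁ h₂ h₃ h₄
  rw [e₀, h₁, h₂, h₃, h₄]
  linear_combination k₁ + k₂ - k₃ + jac'

/-- The definition straightens one chosen descent; the relation at every other descent follows by
confluence. Both one-step reductions are smaller in length or in inversions, so by induction they
can be reduced further to a common value. -/
theorem normalFormCoeff_straightens_aux (n i : ℕ) : ∀ u x y v,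
    (u ++ x :: y :: v).length = n → (u ++ x :: y :: v).inversions = i → y < x →
    Straightens b (normalFormCoeff b T χ) u x y v := by
  induction n using Nat.strong_induction_on generalizing i with
  | _ n ihn =>
  induction i using Nat.strong_induction_on with
  | _ i ihi =>
  intro u x y v hn hi hxy
  have short : ∀ p z₁ z₂ q, p.length + q.length + 2 ≤ n - 1 →
      Straightens b (normalFormCoeff b T χ) p z₁ z₂ q := by
    refine straightens_of_lt b fun p z₁ z₂ q hl hz => ?_
    refine ihn (p.length + q.length + 2) ?_ _ p z₁ z₂ q (by simp; omega) rfl hz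
    simp at hn; omega
  have same : ∀ p z₁ z₂ q, (p ++ z₁ :: z₂ :: q).length = n →
      (p ++ z₁ :: z₂ :: q).inversions < i → z₂ < z₁ →
      Straightens b (normalFormCoeff b T χ) p z₁ z₂ q :=
    fun p z₁ z₂ q hl hj hz => ihi _ hj p z₁ z₂ q hl rfl hz
  have hex : ∃ d, (u ++ x :: y :: v).IsDescent d := ⟨(u, x, y, v), rfl, hxy⟩
  unfold Straightens
  rw [normalFormCoeff, dif_pos hex]
  obtain ⟨heq, hlt⟩ := hex.choose_spec
  generalize hex.choose = d at heq hlt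
  obtain ⟨u', a, c, v'⟩ := d
  dsimp only at heq hlt ⊢
  have swap₁ := List.inversions_append_swap u v hxy
  have swap₂ := List.inversions_append_swap u' v' hlt
  rw [← heq] at swap₂
  rw [hi] at swap₁ swap₂
  have hn' : (u' ++ a :: c :: v').length = n := heq ▸ hn
  -- The two cases put the chosen descent to the right or to the left of the given one, at distance
  -- the length of `s`: 0 is the same descent, 1 an overlap in one letter, and at least 2 a disjoint
  -- pair.
  rcases List.append_eq_append_iff.mp heq with ⟨s, hs, hs'⟩ | ⟨s, hs, hs'⟩
  · rcases s with _ | ⟨s₀, _ | ⟨s₁, t⟩⟩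
    · simp at hs hs'
      obtain ⟨rfl, rfl, rfl⟩ := hs'
      subst hs
      rfl
    · simp at hs'
      obtain ⟨rfl, rfl, rfl⟩ := hs'
      subst hs
      simp only [List.append_assoc, List.singleton_append, List.length_append,
        List.length_cons] at *
      refine (straighten_overlap b (u := u) (v := v') (x := x) (y := y) (z := c)
        (fun p z₁ z₂ q hl => short p z₁ z₂ q (by omega))
        ?_ ?_ ?_ ?_).symm
      · refine same _ _ _ _ (by simp; omega) ?_ (hlt.trans hxy)
        simpa using swap₁
      · have := List.inversions_append_swap (u ++ [y]) v' (hlt.trans hxy)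
        simp only [List.append_assoc, List.singleton_append] at this
        exact same _ _ _ _ (by simp; omega) (this.trans swap₁) hlt
      · exact same _ _ _ _ (by simp; omega) swap₂ (hlt.trans hxy)
      · have := List.inversions_append_swap u (y :: v') (hlt.trans hxy)
        refine same _ _ _ _ (by simp; omega) ?_ hxy
        simp only [List.append_assoc, List.singleton_append]
        exact this.trans swap₂
    · simp only [List.cons_append, List.cons.injEq] at hs'
      obtain ⟨rfl, rfl, rfl⟩ := hs'
      subst hs
      simp only [List.append_assoc, List.cons_append, List.length_append,
        List.length_cons] at *
      refine (straighten_disjoint b (u := u) (t := t) (v := v')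
        (x := x) (y := y) (a := a) (c := c) (fun p z₁ z₂ q hl => short p z₁ z₂ q (by omega)) ?_ ?_).symm
      · refine same _ _ _ _ (by simp; omega) ?_ hlt
        simpa using swap₁
      · exact same _ _ _ _ (by simp; omega) swap₂ hxy
  · rcases s with _ | ⟨s₀, _ | ⟨s₁, t⟩⟩
    · simp at hs hs'
      obtain ⟨rfl, rfl, rfl⟩ := hs'
      subst hs
      rfl
    · simp at hs'
      obtain ⟨rfl, rfl, rfl⟩ := hs'
      subst hs
      simp only [List.append_assoc, List.singleton_append, List.length_append,
        List.length_cons] at *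
      simp only [wordConstr, List.append_assoc, List.cons_append, List.nil_append]
      refine straighten_overlap b (u := u') (v := v) (x := a) (y := c) (z := y)
        (fun p z₁ z₂ q hl => short p z₁ z₂ q (by omega)) ?_ ?_ ?_ ?_
      · refine same _ _ _ _ (by simp; omega) ?_ (hxy.trans hlt)
        simpa using swap₂
      · have := List.inversions_append_swap (u' ++ [c]) v (hxy.trans hlt)
        simp only [List.append_assoc, List.singleton_append] at this
        exact same _ _ _ _ (by simp; omega) (this.trans swap₂) hxy
      · exact same _ _ _ _ (by simp; omega) swap₁ (hxy.trans hlt)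
      · have := List.inversions_append_swap u' (c :: v) (hxy.trans hlt)
        refine same _ _ _ _ (by simp; omega) ?_ hlt
        simp only [List.append_assoc, List.singleton_append]
        exact this.trans swap₁
    · simp only [List.cons_append, List.cons.injEq] at hs'
      obtain ⟨rfl, rfl, rfl⟩ := hs'
      subst hs
      simp only [List.append_assoc, List.cons_append, List.length_append,
        List.length_cons] at *
      simp only [wordConstr, List.append_assoc, List.cons_append]
      refine straighten_disjoint b (u := u') (t := t) (v := v)
        (x := a) (y := c) (a := x) (c := y) (fun p z₁ z₂ q hl => short p z₁ z₂ q (by omega)) ?_ ?_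
      · refine same _ _ _ _ (by simp; omega) ?_ hxy
        simpa using swap₂
      · exact same _ _ _ _ (by simp; omega) swap₁ hlt

theorem normalFormCoeff_straightens (u : List ι) (x y : ι) (v : List ι) :
    Straightens b (normalFormCoeff b T χ) u x y v :=
  straightens_of_lt b (fun u x y v _ h => normalFormCoeff_straightens_aux b T χ _ _ u x y v rfl rfl h)
    u x y v le_rfl

theorem normalFormCoeff_nil : normalFormCoeff b T χ [] = 1 := by
  rw [normalFormCoeff]
  simp

omit [LinearOrder ι] in
theorem wordConstr_eq_of_mem_span {N : List ι → R} {u : List ι}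
    (h : ∀ k ∈ T, N (u ++ [k]) = χ (b k) * N u) {x : g} (hx : x ∈ Submodule.span R (b '' T)) :
    wordConstr b N u [] x = χ x * N u := by
  induction hx using Submodule.span_induction with
  | mem x hx => obtain ⟨k, hk, rfl⟩ := hx; simpa using h k hk
  | zero => simp
  | add x y _ _ hx hy => rw [map_add, map_add, hx, hy, add_mul]
  | smul c x _ hx => rw [map_smul, map_smul, hx, smul_eq_mul, smul_eq_mul, mul_assoc]

variable (hT : ∀ i ∈ T, ∀ j, i ≤ j → j ∈ T)
  (hlie : ∀ i ∈ T, ∀ j ∈ T, ⁅b i, b j⁆ ∈ Submodule.span R (b '' T))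
  (hχ : ∀ i ∈ T, ∀ j ∈ T, χ ⁅b i, b j⁆ = 0)

-- Straightening a descent inside `u` keeps the final letter and induction applies to each term. If
-- the descent involves the final letter `a`, its other letter is larger, hence also in `T`; the
-- bracket term vanishes because `χ` kills brackets of `T`, and the two scalars commute.
include hT hlie hχ in
theorem normalFormCoeff_concat_aux (n i : ℕ) : ∀ u, ∀ a ∈ T,
    (u ++ [a]).length = n → (u ++ [a]).inversions = i →
    normalFormCoeff b T χ (u ++ [a]) = χ (b a) * normalFormCoeff b T χ u := by
  induction n using Nat.strong_induction_on generalizing i with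
  | _ n ihn =>
  induction i using Nat.strong_induction_on with
  | _ i ihi =>
  intro u a ha hn hi
  have short : ∀ u, u.length + 1 < n → ∀ a ∈ T,
      normalFormCoeff b T χ (u ++ [a]) = χ (b a) * normalFormCoeff b T χ u :=
    fun u hu a ha => ihn (u.length + 1) hu _ u a ha (by simp) rfl
  by_cases hex : ∃ d, (u ++ [a]).IsDescent d
  · obtain ⟨⟨u', x, y, v⟩, heq, hlt⟩ := hex
    dsimp only at heq hlt
    have st := normalFormCoeff_straightens b T χ u' x y v
    have swap := List.inversions_append_swap u' v hlt
    rw [← heq, hi] at swap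
    unfold Straightens at st
    rw [heq, st]
    rcases v.eq_nil_or_concat with rfl | ⟨v, z, rfl⟩
    · have heq' : u ++ [a] = (u' ++ [x]) ++ [y] := by simpa using heq
      obtain ⟨rfl, h⟩ := List.append_inj' heq' rfl
      obtain rfl : a = y := by simpa using h
      have hx : x ∈ T := hT a ha x hlt.le
      simp only [List.length_append, List.length_cons, List.length_nil] at hn
      rw [wordConstr_eq_of_mem_span b T χ (short u' (by omega)) (hlie x hx a ha), hχ x hx a ha,
        zero_mul, add_zero, short u' (by omega) x hx]
      have := ihi _ swap (u' ++ [a]) x hx (by simp; omega) (by simp)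
      rw [List.append_assoc, List.singleton_append] at this
      rw [this, short u' (by omega) a ha]
      ring
    · have heq' : u ++ [a] = (u' ++ x :: y :: v) ++ [z] := by simpa using heq
      obtain ⟨rfl, h⟩ := List.append_inj' heq' rfl
      obtain rfl : a = z := by simpa using h
      have st' := normalFormCoeff_straightens b T χ u' x y v
      unfold Straightens at st'
      simp only [List.length_append, List.length_cons, List.length_nil] at hn
      have e := ihi _ swap (u' ++ y :: x :: v) a ha (by simp; omega) (by simp)
      simp only [List.append_assoc, List.cons_append, List.concat_eq_append] at e ⊢
      rw [st', e, mul_add, wordConstr, wordConstr, ← smul_eq_mul (χ (b a)) (b.constr R _ _),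
        ← LinearMap.smul_apply, ← map_smul]
      congr 3
      funext k
      have := short (u' ++ k :: v) (by simp; omega) a ha
      simpa using this
  · rw [normalFormCoeff, dif_neg hex]
    have hex' : ∃ p : List ι × ι, u ++ [a] = p.1 ++ [p.2] ∧ p.2 ∈ T := ⟨(u, a), rfl, ha⟩
    rw [dif_pos hex']
    obtain ⟨h₁, h₂⟩ := List.append_inj' hex'.choose_spec.1 rfl
    rw [← h₁, ← (List.cons.inj h₂).1]

include hT hlie hχ in
theorem normalFormCoeff_concat (u : List ι) {a : ι} (ha : a ∈ T) :
    normalFormCoeff b T χ (u ++ [a]) = χ (b a) * normalFormCoeff b T χ u :=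
  normalFormCoeff_concat_aux b T χ hT hlie hχ _ _ u a ha rfl rfl

end NormalForm

/-! ### Representations realizing a character, and modules induced from one. -/

noncomputable section CharacterModules

universe u v

variable {R : Type u} [CommRing R] {g : Type*} [LieRing g] [LieAlgebra R g] {ι : Type v}

theorem exists_linearOrder_isUpper {ι : Type*} (T : Set ι) :
    ∃ o : LinearOrder ι, ∀ i ∈ T, ∀ j, o.le i j → j ∈ T := by
  classical
  let o₁ : LinearOrder ι := linearOrderOfSTO WellOrderingRel
  -- Membership in `T` is compared first, which places `T` on top; a well-ordering breaks ties.
  let f : ι → Bool ×ₗ ι := fun i => toLex (decide (i ∈ T), i)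
  have hf : Function.Injective f := fun i j h => (Prod.ext_iff.mp (toLex.injective h)).2
  refine ⟨LinearOrder.lift' f hf, fun i hi j hij => ?_⟩
  have hij' : f i ≤ f j := hij
  rw [Prod.Lex.le_iff] at hij'
  by_contra hj
  simp only [f, hi, hj, ofLex_toLex, decide_true, decide_false] at hij'
  rcases hij' with h | h
  · exact absurd h (by decide)
  · exact absurd h.1 (by decide)

section

variable (b : Module.Basis ι R g)

/-- The action of `g` on formal combinations of words by prepending letters. -/
def wordAction : g →ₗ[R] Module.End R (List ι →₀ R) :=
  b.constr R fun i => Finsupp.lmapDomain R R (List.cons i)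

theorem wordAction_basis_single (i : ι) (t : List ι) (r : R) :
    wordAction b (b i) (Finsupp.single t r) = Finsupp.single (i :: t) r := by
  simp [wordAction]

/-- The value of a function on words at a formal combination of words with a common prefix. -/
def wordValue (N : List ι → R) (p : List ι) : (List ι →₀ R) →ₗ[R] R :=
  Finsupp.linearCombination R fun t => N (p ++ t)

theorem wordValue_single (N : List ι → R) (p t : List ι) (r : R) :
    wordValue N p (Finsupp.single t r) = r * N (p ++ t) := by
  simp [wordValue]

theorem wordValue_wordAction_basis (N : List ι → R) (p : List ι) (i : ι) (v : List ι →₀ R) :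
    wordValue N p (wordAction b (b i) v) = wordValue N (p ++ [i]) v := by
  induction v using Finsupp.induction_linear with
  | zero => simp
  | add v v' h h' => simp only [map_add, h, h']
  | single t r => simp [wordAction_basis_single, wordValue_single]

theorem wordValue_wordAction_single (N : List ι → R) (p t : List ι) (r : R) (x : g) :
    wordValue N p (wordAction b x (Finsupp.single t r)) = r * wordConstr b N p t x := by
  have : wordValue N p ∘ₗ (wordAction b).flip (Finsupp.single t r) = r • wordConstr b N p t := by
    refine b.ext fun i => ?_
    simp [wordAction_basis_single, wordValue_single]
  simpa using congrArg (fun f => f x) this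

/-- The largest subspace of the kernel of a function on words that is stable under prepending. -/
def wordRadical (N : List ι → R) : Submodule R (List ι →₀ R) :=
  ⨅ p, LinearMap.ker (wordValue N p)

theorem mem_wordRadical {N : List ι → R} {v : List ι →₀ R} :
    v ∈ wordRadical N ↔ ∀ p, wordValue N p v = 0 := by
  simp [wordRadical]

theorem wordAction_mem_wordRadical (N : List ι → R) (x : g) :
    wordRadical N ≤ (wordRadical N).comap (wordAction b x) := by
  intro v hv
  rw [mem_wordRadical] at hv
  rw [Submodule.mem_comap, mem_wordRadical]
  intro p
  have : wordValue N p ∘ₗ (wordAction b).flip v = 0 := by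
    refine b.ext fun i => ?_
    simpa using (wordValue_wordAction_basis b N p i v).trans (hv _)
  simpa using congrArg (fun f => f x) this

/-- Prepending letters is a free action; the straightening relations say exactly that the commutator
identity holds modulo the radical. -/
theorem wordAction_lie_sub_mem {N : List ι → R} (h : ∀ u x y v, Straightens b N u x y v)
    (x y : g) (v : List ι →₀ R) :
    wordAction b ⁅x, y⁆ v - (wordAction b x (wordAction b y v) -
      wordAction b y (wordAction b x v)) ∈ wordRadical N := by
  induction b.mem_span x using Submodule.span_induction with
  | zero => simp
  | add x x' _ _ hx hx' =>
    convert add_mem hx hx' using 1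
    simp only [add_lie, map_add, LinearMap.add_apply]; abel
  | smul c x _ hx =>
    convert Submodule.smul_mem _ c hx using 1
    simp only [smul_lie, map_smul, LinearMap.smul_apply, smul_sub]
  | mem x hx =>
  obtain ⟨i, rfl⟩ := hx
  induction b.mem_span y using Submodule.span_induction with
  | zero => simp
  | add y y' _ _ hy hy' =>
    convert add_mem hy hy' using 1
    simp only [lie_add, map_add, LinearMap.add_apply]; abel
  | smul c y _ hy =>
    convert Submodule.smul_mem _ c hy using 1
    simp only [lie_smul, map_smul, LinearMap.smul_apply, smul_sub]
  | mem y hy =>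
  obtain ⟨j, rfl⟩ := hy
  induction v using Finsupp.induction_linear with
  | zero => simp
  | add v v' hv hv' =>
    convert add_mem hv hv' using 1
    simp only [map_add]; abel
  | single t r =>
    rw [mem_wordRadical]
    intro p
    have := h p i j t
    unfold Straightens at this
    rw [map_sub, map_sub, wordValue_wordAction_single, wordAction_basis_single,
      wordAction_basis_single, wordAction_basis_single, wordAction_basis_single, wordValue_single,
      wordValue_single, this]
    ring

attribute [local instance 100] LieRing.ofAssociativeRing

/-- The representation of `g` on the quotient of the space of words by the radical of a function
satisfying the straightening relations. -/
def wordRep {N : List ι → R} (h : ∀ u x y v, Straightens b N u x y v) :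
    g →ₗ⁅R⁆ Module.End R ((List ι →₀ R) ⧸ wordRadical N) where
  toFun x := (wordRadical N).mapQ _ (wordAction b x) (wordAction_mem_wordRadical b N x)
  map_add' x y := by
    ext v; simp
  map_smul' c x := by
    ext v; simp
  map_lie' {x y} := by
    refine Submodule.linearMap_qext _ (LinearMap.ext fun v => ?_)
    rw [LieRing.of_associative_ring_bracket]
    exact (Submodule.Quotient.eq _).mpr (wordAction_lie_sub_mem b h x y v)

/-- A character of the subalgebra spanned by part of a basis of `g` is the weight of a nonzero
vector in some representation of `g`. -/
theorem exists_representation_of_character [Nontrivial R] (T : Set ι) (χ : g →ₗ[R] R)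
    (hlie : ∀ i ∈ T, ∀ j ∈ T, ⁅b i, b j⁆ ∈ Submodule.span R (b '' T))
    (hχ : ∀ i ∈ T, ∀ j ∈ T, χ ⁅b i, b j⁆ = 0) :
    ∃ (M : Type (max u v)) (_ : AddCommGroup M) (_ : Module R M) (ρ : g →ₗ⁅R⁆ Module.End R M) (w : M),
      w ≠ 0 ∧ ∀ i ∈ T, ρ (b i) w = χ (b i) • w := by
  obtain ⟨o, ho⟩ := exists_linearOrder_isUpper T
  refine ⟨(List ι →₀ R) ⧸ wordRadical (normalFormCoeff b T χ), inferInstance, inferInstance,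
    wordRep b (normalFormCoeff_straightens b T χ), Submodule.Quotient.mk (Finsupp.single [] 1),
    fun h => ?_, fun i hi => ?_⟩
  -- The empty word survives in the quotient because its constant term is 1.
  · have := mem_wordRadical.mp ((Submodule.Quotient.mk_eq_zero _).mp h) []
    rw [wordValue_single, List.append_nil, normalFormCoeff_nil, mul_one] at this
    exact one_ne_zero this
  · refine (Submodule.Quotient.eq _).mpr (mem_wordRadical.mpr fun p => ?_)
    rw [map_sub, map_smul, wordAction_basis_single, wordValue_single, wordValue_single,
      normalFormCoeff_concat b T χ ho hlie hχ p hi]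
    simp

end

section

variable (h : LieSubalgebra R g) (χ : LieAlgebra.LieCharacter R h)

/-- The canonical generator of the module induced from a character. -/
def LieSubalgebra.inducedGenerator : h.Induced χ.OneDim :=
  Submodule.Quotient.mk ((1 : UniversalEnvelopingAlgebra R g) ⊗ₜ[R] (show χ.OneDim from (1 : R)))

attribute [local instance 100] LieRing.ofAssociativeRing

theorem LieSubalgebra.lie_inducedGenerator (x : h) :
    ⁅(x : g), h.inducedGenerator χ⁆ = χ x • h.inducedGenerator χ := by
  have key : (UniversalEnvelopingAlgebra.ι R (x : g) * 1) ⊗ₜ[R] (show χ.OneDim from (1 : R)) -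
      χ x • ((1 : UniversalEnvelopingAlgebra R g) ⊗ₜ[R] (show χ.OneDim from (1 : R))) ∈
      h.inducedRelations χ.OneDim := by
    refine Submodule.subset_span ⟨1, UniversalEnvelopingAlgebra.ι R x, (1 : R), ?_⟩
    rw [LieSubalgebra.envelopingMap, UniversalEnvelopingAlgebra.lift_ι_apply, envelopingAction,
      UniversalEnvelopingAlgebra.lift_ι_apply, mul_one, one_mul, ← TensorProduct.tmul_smul]
    rfl
  exact (Submodule.Quotient.eq _).mpr key

/-- The stabilizer `A` of `N` is a subalgebra containing the image of `g`. The universal property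
gives a map into `A` whose composite with the inclusion is the identity, so `A` is everything. -/
theorem UniversalEnvelopingAlgebra.smul_mem_of_ι_smul_mem {M : Type*} [AddCommGroup M] [Module R M]
    [Module (UniversalEnvelopingAlgebra R g) M]
    [IsScalarTower R (UniversalEnvelopingAlgebra R g) M] (N : Submodule R M)
    (hN : ∀ x : g, ∀ m ∈ N, UniversalEnvelopingAlgebra.ι R x • m ∈ N)
    (u : UniversalEnvelopingAlgebra R g) {m : M} (hm : m ∈ N) : u • m ∈ N := by
  let A : Subalgebra R (UniversalEnvelopingAlgebra R g) :=
    { carrier := {u | ∀ m ∈ N, u • m ∈ N}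
      mul_mem' := fun {a b} ha hb m hm => by rw [mul_smul]; exact ha _ (hb _ hm)
      add_mem' := fun {a b} ha hb m hm => by rw [add_smul]; exact add_mem (ha _ hm) (hb _ hm)
      algebraMap_mem' := fun r m hm => by rw [algebraMap_smul]; exact N.smul_mem r hm }
  let f : g →ₗ⁅R⁆ A :=
    { toFun := fun x => ⟨UniversalEnvelopingAlgebra.ι R x, hN x⟩
      map_add' := fun x y => Subtype.ext (map_add _ x y)
      map_smul' := fun c x => Subtype.ext (map_smul _ c x)
      map_lie' := fun {x y} => Subtype.ext (LieHom.map_lie (UniversalEnvelopingAlgebra.ι R) x y) }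
  have : A.val.comp (UniversalEnvelopingAlgebra.lift R f) =
      AlgHom.id R (UniversalEnvelopingAlgebra R g) := by
    refine UniversalEnvelopingAlgebra.hom_ext R (LieHom.ext fun x => ?_)
    change ((UniversalEnvelopingAlgebra.lift R f (UniversalEnvelopingAlgebra.ι R x) : A) : _) =
      UniversalEnvelopingAlgebra.ι R x
    rw [UniversalEnvelopingAlgebra.lift_ι_apply]
    rfl
  have hu := congrArg (fun f => f u) this
  change ((UniversalEnvelopingAlgebra.lift R f u : A) : _) = u at hu
  rw [← hu]
  exact (UniversalEnvelopingAlgebra.lift R f u).2 m hm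

theorem LieSubalgebra.eq_top_of_inducedGenerator_mem (N : LieSubmodule R g (h.Induced χ.OneDim))
    (hN : h.inducedGenerator χ ∈ N) : N = ⊤ := by
  rw [eq_top_iff]
  rintro t -
  induction t using Submodule.Quotient.induction_on with
  | _ t =>
  induction t using TensorProduct.induction_on with
  | zero => exact N.zero_mem
  | add s t hs ht => exact N.add_mem hs ht
  | tmul u c =>
    have := UniversalEnvelopingAlgebra.smul_mem_of_ι_smul_mem N.toSubmodule
      (fun x m hm => N.lie_mem (x := x) hm) u (N.smul_mem (show R from c) hN)
    convert this using 1
    have e : u ⊗ₜ[R] c = (show R from c) •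
        u • ((1 : UniversalEnvelopingAlgebra R g) ⊗ₜ[R] (show χ.OneDim from (1 : R))) := by
      rw [TensorProduct.smul_tmul', smul_eq_mul, mul_one, ← TensorProduct.tmul_smul]
      congr 1
      exact (mul_one (show R from c)).symm
    rw [e, smul_comm u]
    rfl

/-- The universal property of the module induced from a character. -/
theorem LieSubalgebra.exists_induced_lift {M : Type*} [AddCommGroup M] [Module R M]
    (ρ : g →ₗ⁅R⁆ Module.End R M) (w : M) (hw : ∀ x : h, ρ x w = χ x • w) :
    ∃ f : h.Induced χ.OneDim →ₗ[R] M,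
      (∀ (x : g) t, f ⁅x, t⁆ = ρ x (f t)) ∧ f (h.inducedGenerator χ) = w := by
  let Φ := UniversalEnvelopingAlgebra.lift R ρ
  let _ : Module (UniversalEnvelopingAlgebra R g) M := Module.compHom M Φ.toRingHom
  have smul_def (u : UniversalEnvelopingAlgebra R g) (m : M) : u • m = Φ u m := rfl
  let F₀ : UniversalEnvelopingAlgebra R g →ₗ[R] χ.OneDim →ₗ[R] M :=
    LinearMap.mk₂ R (fun u c => (show R from c) • Φ u w)
      (fun u u' c => by rw [map_add, LinearMap.add_apply, smul_add])
      (fun r u c => by rw [map_smul, LinearMap.smul_apply, smul_comm])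
      (fun u c c' => add_smul _ _ _) (fun r u c => mul_smul _ _ _)
  let F₁ := TensorProduct.lift F₀
  have F₁_tmul (u : UniversalEnvelopingAlgebra R g) (c : χ.OneDim) :
      F₁ (u ⊗ₜ c) = (show R from c) • Φ u w := rfl
  let F : UniversalEnvelopingAlgebra R g ⊗[R] χ.OneDim →ₗ[UniversalEnvelopingAlgebra R g] M :=
    { toFun := F₁
      map_add' := map_add F₁
      map_smul' := fun u t => by
        change F₁ (u • t) = Φ u (F₁ t)
        induction t using TensorProduct.induction_on with
        | zero => rw [smul_zero, map_zero, map_zero]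
        | add s t hs ht => rw [smul_add, map_add, map_add, map_add, hs, ht]
        | tmul v c =>
          rw [TensorProduct.smul_tmul', F₁_tmul, F₁_tmul, smul_eq_mul, map_mul, map_smul]
          rfl }
  -- Both sides are computed by the algebra homomorphism `χ'` extending `χ` to the enveloping
  -- algebra of `h`. For the action on `w`, the elements acting through `χ'` contain 1 and are
  -- stable under left multiplication by `h`.
  have haction (a : UniversalEnvelopingAlgebra R h) (c : χ.OneDim) :
      (show R from c) • Φ (h.envelopingMap a) w =
        (show R from envelopingAction R h χ.OneDim a c) • w := by
    let χ' : UniversalEnvelopingAlgebra R h →ₐ[R] R := UniversalEnvelopingAlgebra.lift R χ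
    have h₁ : ∀ c : χ.OneDim, (show R from envelopingAction R h χ.OneDim a c) =
        χ' a * (show R from c) := by
      have : envelopingAction R h χ.OneDim = (Algebra.ofId R (Module.End R χ.OneDim)).comp χ' := by
        refine UniversalEnvelopingAlgebra.hom_ext R (LieHom.ext fun x => ?_)
        change envelopingAction R h χ.OneDim (UniversalEnvelopingAlgebra.ι R x) =
          algebraMap R _ (χ' (UniversalEnvelopingAlgebra.ι R x))
        rw [envelopingAction, UniversalEnvelopingAlgebra.lift_ι_apply,
          UniversalEnvelopingAlgebra.lift_ι_apply]
        rfl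
      intro c
      rw [this]
      rfl
    have h₂ : Φ (h.envelopingMap a) w = χ' a • w := by
      let N : Submodule R (UniversalEnvelopingAlgebra R h) :=
        { carrier := {a | Φ (h.envelopingMap a) w = χ' a • w}
          add_mem' := fun {a a'} ha ha' => by
            change Φ (h.envelopingMap (a + a')) w = χ' (a + a') • w
            change _ = _ at ha ha'
            rw [map_add, map_add, map_add, LinearMap.add_apply, ha, ha', add_smul]
          zero_mem' := by simp
          smul_mem' := fun r a ha => by
            change Φ (h.envelopingMap (r • a)) w = χ' (r • a) • w
            change _ = _ at ha
            rw [map_smul, map_smul, map_smul, LinearMap.smul_apply, ha, smul_assoc] }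
      have := UniversalEnvelopingAlgebra.smul_mem_of_ι_smul_mem N (fun x b hb => ?_) a
        (m := 1) (by change Φ (h.envelopingMap 1) w = χ' 1 • w; simp)
      · rw [smul_eq_mul, mul_one] at this
        exact this
      · change Φ (h.envelopingMap (UniversalEnvelopingAlgebra.ι R x * b)) w =
          χ' (UniversalEnvelopingAlgebra.ι R x * b) • w
        have hb' : Φ (h.envelopingMap b) w = χ' b • w := hb
        rw [map_mul, map_mul, map_mul, Module.End.mul_apply, hb', map_smul,
          LieSubalgebra.envelopingMap, UniversalEnvelopingAlgebra.lift_ι_apply,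
          UniversalEnvelopingAlgebra.lift_ι_apply, LieHom.comp_apply,
          UniversalEnvelopingAlgebra.lift_ι_apply, LieSubalgebra.coe_incl, hw, mul_comm, mul_smul]
    rw [h₁, h₂, smul_smul, mul_comm]
  have hF : h.inducedRelations χ.OneDim ≤ LinearMap.ker F := by
    refine Submodule.span_le.mpr ?_
    rintro _ ⟨u, a, c, rfl⟩
    change F₁ _ = 0
    rw [map_sub, F₁_tmul, F₁_tmul, map_mul, Module.End.mul_apply, ← map_smul, haction, map_smul,
      sub_self]
  let f := (h.inducedRelations χ.OneDim).liftQ F hF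
  have f_smul (u : UniversalEnvelopingAlgebra R g) (t : h.Induced χ.OneDim) :
      f (u • t) = Φ u (f t) := map_smul f u t
  refine ⟨{ toFun := f, map_add' := map_add f, map_smul' := fun r t => ?_ }, fun x t => ?_, ?_⟩
  · rw [← algebraMap_smul (UniversalEnvelopingAlgebra R g) r t, f_smul, AlgHom.commutes]
    rfl
  · change f (UniversalEnvelopingAlgebra.ι R x • t) = ρ x (f t)
    rw [f_smul, UniversalEnvelopingAlgebra.lift_ι_apply]
  · change (1 : R) • Φ 1 w = w
    rw [map_one, one_smul, Module.End.one_apply]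

end

end CharacterModules

/-! ### Reducibility when ψ vanishes on I or J at index m+n-1. -/

noncomputable section WhittakerReducible

namespace PlanarGalilean

variable {m n : ℕ} (ψ : WhittakerFunction m n)

open Classical in
/-- The linear extension of a Whittaker function that takes the value `r` on all basis elements
outside of `𝒢^{(m,n)}`. -/
def WhittakerFunction.extend (r : ℂ) : PlanarGalilean →ₗ[ℂ] ℂ :=
  basis.constr ℂ fun k => if h : k.Mem m n then ψ ⟨basis k, basis_mem_subalgebra h⟩ else r

theorem WhittakerFunction.extend_basis_of_not_mem (r : ℂ) {k : Gen} (h : ¬ k.Mem m n) :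
    WhittakerFunction.extend ψ r (basis k) = r := by
  simp [WhittakerFunction.extend, h]

theorem WhittakerFunction.extend_apply (r : ℂ) (x : subalgebra m n) :
    WhittakerFunction.extend ψ r x = ψ x := by
  obtain ⟨x, hx⟩ := x
  induction hx using Submodule.span_induction with
  | mem x hx =>
    obtain ⟨k, hk, rfl⟩ := hx
    have hk' : k.Mem m n := hk
    simp [WhittakerFunction.extend, hk']
  | zero => exact (map_zero _).trans (map_zero ψ).symm
  | add x y hx hy hx' hy' =>
    exact (map_add _ x y).trans ((congrArg₂ _ hx' hy').trans (map_add ψ ⟨x, hx⟩ ⟨y, hy⟩).symm)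
  | smul c x hx hx' =>
    exact (map_smul _ c x).trans ((congrArg _ hx').trans (map_smul ψ c ⟨x, hx⟩).symm)

theorem WhittakerFunction.extend_genBracket (r : ℂ) {i j : Gen} (hi : i.Mem m n) (hj : j.Mem m n) :
    WhittakerFunction.extend ψ r (genBracket i j) = 0 := by
  rw [← lie_basis]
  refine (WhittakerFunction.extend_apply ψ r
    ⁅(⟨basis i, basis_mem_subalgebra hi⟩ : subalgebra m n),
      (⟨basis j, basis_mem_subalgebra hj⟩ : subalgebra m n)⁆).trans ?_
  exact LieAlgebra.lieCharacter_apply_lie ψ _ _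

/-- I_k is the bracket of H_m and I_{k-m}, both in the subalgebra, and a character kills brackets.
-/
theorem WhittakerFunction.extend_I (r : ℂ) {k : ℤ} (hk : (m : ℤ) + n ≤ k) :
    WhittakerFunction.extend ψ r (I k) = 0 := by
  have := WhittakerFunction.extend_genBracket ψ r (i := .H m) (j := .I (k - m)) (by simp [Gen.Mem])
    (by simp only [Gen.Mem]; omega)
  simpa [genBracket] using this

theorem WhittakerFunction.extend_J (r : ℂ) {k : ℤ} (hk : (m : ℤ) + n ≤ k) :
    WhittakerFunction.extend ψ r (J k) = 0 := by
  have := WhittakerFunction.extend_genBracket ψ r (i := .H m) (j := .J (k - m)) (by simp [Gen.Mem])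
    (by simp only [Gen.Mem]; omega)
  simpa [genBracket] using this

/-- If the Whittaker function extends to a character `χ` of the subalgebra spanned by a larger set
`T` of basis elements, then some proper submodule of the Whittaker module contains `x w - χ(x) w`
for all `x` in that subalgebra, `w` being the generator. -/
theorem exists_submodule_of_character (T : Set Gen) (hT : {k | k.Mem m n} ⊆ T)
    (χ : PlanarGalilean →ₗ[ℂ] ℂ)
    (hχψ : ∀ k : Gen, k.Mem m n → χ (basis k) = WhittakerFunction.extend ψ 0 (basis k))
    (hlie : ∀ i ∈ T, ∀ j ∈ T, ⁅basis i, basis j⁆ ∈ Submodule.span ℂ (basis '' T))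
    (hχ : ∀ i ∈ T, ∀ j ∈ T, χ ⁅basis i, basis j⁆ = 0) :
    ∃ N : LieSubmodule ℂ PlanarGalilean (WhittakerModule ψ),
      (subalgebra m n).inducedGenerator ψ ∉ N ∧
        ∀ k ∈ T, ⁅basis k, (subalgebra m n).inducedGenerator ψ⁆ -
          χ (basis k) • (subalgebra m n).inducedGenerator ψ ∈ N := by
  obtain ⟨M, _, _, ρ, w, hw, hρ⟩ := exists_representation_of_character basis T χ hlie hχ
  obtain ⟨f, hf, hfw⟩ := (subalgebra m n).exists_induced_lift ψ ρ w (fun x => by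
    rw [← WhittakerFunction.extend_apply ψ 0 x]
    obtain ⟨x, hx⟩ := x
    change ρ x w = WhittakerFunction.extend ψ 0 x • w
    change x ∈ Submodule.span ℂ _ at hx
    induction hx using Submodule.span_induction with
    | mem x hx =>
      obtain ⟨k, hk, rfl⟩ := hx
      rw [hρ k (hT hk), hχψ k hk]
    | zero => rw [map_zero, map_zero, zero_smul, LinearMap.zero_apply]
    | add x y hx hy hx' hy' => rw [map_add, map_add, LinearMap.add_apply, hx', hy', add_smul]
    | smul c x hx hx' => rw [map_smul, map_smul, LinearMap.smul_apply, hx', smul_assoc])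
  refine ⟨{ LinearMap.ker f with lie_mem := fun {x t} ht => ?_ }, fun h => hw ?_, fun k hk => ?_⟩
  · have ht' : f t = 0 := ht
    change f ⁅x, t⁆ = 0
    rw [hf, ht', map_zero]
  · rw [← hfw]
    exact h
  · change f _ = 0
    rw [map_sub, hf, map_smul, hfw, hρ k hk, sub_self]

/-- With `T` just the basis of the subalgebra, the construction yields a submodule that misses the
generator. -/
theorem inducedGenerator_ne_zero : (subalgebra m n).inducedGenerator ψ ≠ 0 := by
  obtain ⟨N, hN, -⟩ := exists_submodule_of_character ψ {k | k.Mem m n} subset_rfl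
    (WhittakerFunction.extend ψ 0) (fun _ _ => rfl)
    (fun i hi j hj =>
      (subalgebra m n).lie_mem (basis_mem_subalgebra hi) (basis_mem_subalgebra hj))
    (fun i hi j hj => by
      rw [lie_basis]
      exact WhittakerFunction.extend_genBracket ψ 0 hi hj)
  exact fun h => hN (h ▸ N.zero_mem)

/-- Since `z` normalizes the subalgebra and ψ kills the resulting brackets, the value of an extended
character at `z` is unconstrained. -/
theorem exists_submodule_of_extension (z : Gen) (hz : ¬ z.Mem m n)
    (hlie : ∀ k : Gen, k.Mem m n → ⁅basis z, basis k⁆ ∈ subalgebra m n)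
    (hψ : ∀ k : Gen, k.Mem m n → WhittakerFunction.extend ψ 0 ⁅basis z, basis k⁆ = 0) (r : ℂ) :
    ∃ N : LieSubmodule ℂ PlanarGalilean (WhittakerModule ψ),
      (subalgebra m n).inducedGenerator ψ ∉ N ∧
        ⁅basis z, (subalgebra m n).inducedGenerator ψ⁆ -
          r • (subalgebra m n).inducedGenerator ψ ∈ N := by
  have hψ' (x : PlanarGalilean) (hx : x ∈ subalgebra m n) :
      WhittakerFunction.extend ψ r x = WhittakerFunction.extend ψ 0 x :=
    (WhittakerFunction.extend_apply ψ r ⟨x, hx⟩).trans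
      (WhittakerFunction.extend_apply ψ 0 ⟨x, hx⟩).symm
  have hle (x : PlanarGalilean) (hx : x ∈ subalgebra m n) :
      x ∈ Submodule.span ℂ (basis '' ({k | k.Mem m n} ∪ {z})) :=
    Submodule.span_mono (Set.image_mono Set.subset_union_left) hx
  have hlie' : ∀ i ∈ {k : Gen | k.Mem m n} ∪ {z}, ∀ j ∈ {k : Gen | k.Mem m n} ∪ {z},
      ⁅basis i, basis j⁆ ∈ Submodule.span ℂ (basis '' ({k | k.Mem m n} ∪ {z})) := by
    rintro i (hi | rfl) j (hj | rfl)
    · exact hle _ ((subalgebra m n).lie_mem (basis_mem_subalgebra hi) (basis_mem_subalgebra hj))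
    · rw [← lie_skew]
      exact neg_mem (hle _ (hlie i hi))
    · exact hle _ (hlie j hj)
    · rw [lie_self]
      exact zero_mem _
  have hχ : ∀ i ∈ {k : Gen | k.Mem m n} ∪ {z}, ∀ j ∈ {k : Gen | k.Mem m n} ∪ {z},
      WhittakerFunction.extend ψ r ⁅basis i, basis j⁆ = 0 := by
    rintro i (hi | rfl) j (hj | rfl)
    · rw [lie_basis]
      exact WhittakerFunction.extend_genBracket ψ r hi hj
    · rw [← lie_skew, map_neg, hψ' _ (hlie i hi), hψ i hi, neg_zero]
    · rw [hψ' _ (hlie j hj), hψ j hj]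
    · rw [lie_self, map_zero]
  obtain ⟨N, hN, hN'⟩ := exists_submodule_of_character ψ _ Set.subset_union_left
    (WhittakerFunction.extend ψ r) (fun k hk => hψ' _ (basis_mem_subalgebra hk)) hlie' hχ
  refine ⟨N, hN, ?_⟩
  have := hN' z (Or.inr rfl)
  rwa [WhittakerFunction.extend_basis_of_not_mem ψ r hz] at this

/-- In an irreducible module the proper submodules for `r = 0` and `r = 1` both vanish, so `z` would
act on the generator by two different scalars. -/
theorem not_isIrreducible_of_extension (z : Gen) (hz : ¬ z.Mem m n)
    (hlie : ∀ k : Gen, k.Mem m n → ⁅basis z, basis k⁆ ∈ subalgebra m n)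
    (hψ : ∀ k : Gen, k.Mem m n → WhittakerFunction.extend ψ 0 ⁅basis z, basis k⁆ = 0) :
    ¬ LieModule.IsIrreducible ℂ PlanarGalilean (WhittakerModule ψ) := by
  intro h
  have key (r : ℂ) : (subalgebra m n).inducedGenerator ψ ≠ 0 ∧
      ⁅basis z, (subalgebra m n).inducedGenerator ψ⁆ = r • (subalgebra m n).inducedGenerator ψ := by
    obtain ⟨N, hN, hN'⟩ := exists_submodule_of_extension ψ z hz hlie hψ r
    rcases h.eq_bot_or_eq_top N with rfl | rfl
    · exact ⟨fun h0 => hN (h0 ▸ LieSubmodule.zero_mem _), sub_eq_zero.mp hN'⟩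
    · exact absurd (LieSubmodule.mem_top _) hN
  have h₀ := (key 0).2
  rw [(key 1).2, one_smul, zero_smul] at h₀
  exact (key 0).1 h₀

theorem not_isIrreducible_of_I (hm : 0 < m)
    (h : WhittakerFunction.extend ψ 0 (I ((m : ℤ) + n - 1)) = 0) :
    ¬ LieModule.IsIrreducible ℂ PlanarGalilean (WhittakerModule ψ) := by
  have hI (k : ℤ) (hk : (m : ℤ) ≤ k) : WhittakerFunction.extend ψ 0 (I (k + (n - 1))) = 0 := by
    rcases hk.eq_or_lt with rfl | hk
    · rwa [← add_sub_assoc]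
    · exact WhittakerFunction.extend_I ψ 0 (by omega)
  -- The nonzero brackets of I_{n-1} with the subalgebra are multiples of I_k with k ≥ m+n-1. These
  -- lie in the subalgebra because m ≥ 1, and ψ kills them: by hypothesis at m+n-1, automatically
  -- beyond.
  refine not_isIrreducible_of_extension ψ (.I (n - 1)) (by simp [Gen.Mem]) (fun k hk => ?_)
    (fun k hk => ?_)
  · rw [lie_basis]
    cases k <;> simp only [Gen.Mem] at hk <;> simp only [genBracket, zero_mem] <;>
      (repeat' first | apply neg_mem | apply Submodule.smul_mem) <;>
      exact I_mem_subalgebra (by omega)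
  · rw [lie_basis]
    cases k <;> simp only [Gen.Mem] at hk <;>
      simp only [genBracket, map_zero, map_neg, map_smul] <;>
      simp only [hI _ hk, smul_zero, neg_zero]

theorem not_isIrreducible_of_J (hm : 0 < m)
    (h : WhittakerFunction.extend ψ 0 (J ((m : ℤ) + n - 1)) = 0) :
    ¬ LieModule.IsIrreducible ℂ PlanarGalilean (WhittakerModule ψ) := by
  have hJ (k : ℤ) (hk : (m : ℤ) ≤ k) : WhittakerFunction.extend ψ 0 (J (k + (n - 1))) = 0 := by
    rcases hk.eq_or_lt with rfl | hk
    · rwa [← add_sub_assoc]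
    · exact WhittakerFunction.extend_J ψ 0 (by omega)
  refine not_isIrreducible_of_extension ψ (.J (n - 1)) (by simp [Gen.Mem]) (fun k hk => ?_)
    (fun k hk => ?_)
  · rw [lie_basis]
    cases k <;> simp only [Gen.Mem] at hk <;> simp only [genBracket, zero_mem] <;>
      (repeat' first | apply neg_mem | apply Submodule.smul_mem) <;>
      exact J_mem_subalgebra (by omega)
  · rw [lie_basis]
    cases k <;> simp only [Gen.Mem] at hk <;>
      simp only [genBracket, map_zero, map_neg, map_smul] <;>
      simp only [hJ _ hk, smul_zero, neg_zero]

end PlanarGalilean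

end WhittakerReducible

/-! ### Degree filtrations and formal derivatives. -/

section DegreeFiltration

variable {k : Type*} [Field k] {g : Type*} [LieRing g] [LieAlgebra k g] {M : Type*}
  [AddCommGroup M] [Module k M] [LieRingModule g M] [LieModule k g M] {Y : Type*}

/-- `HasFormalDeriv q S d v δ` says that `v` is a combination of words of length at most `d` in the
operators `q y` applied to vectors of `S`, with formal partial derivative `δ y` with respect to
the letter `y`. -/
inductive HasFormalDeriv (q : Y → g) (S : Submodule k M) : ℕ → M → (Y →₀ M) → Prop
  | base {s : M} (hs : s ∈ S) : HasFormalDeriv q S 0 s 0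
  | cons {d : ℕ} {v : M} {δ : Y →₀ M} (y : Y) (h : HasFormalDeriv q S d v δ) :
      HasFormalDeriv q S (d + 1) ⁅q y, v⁆
        (Finsupp.single y v + δ.mapRange (fun u => ⁅q y, u⁆) (lie_zero (q y)))
  | add {d : ℕ} {v v' : M} {δ δ' : Y →₀ M} (h : HasFormalDeriv q S d v δ)
      (h' : HasFormalDeriv q S d v' δ') : HasFormalDeriv q S d (v + v') (δ + δ')
  | succ {d : ℕ} {v : M} {δ : Y →₀ M} (h : HasFormalDeriv q S d v δ) :
      HasFormalDeriv q S (d + 1) v δ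

variable {q : Y → g} {S : Submodule k M}

omit [LieAlgebra k g] [LieModule k g M] in
theorem HasFormalDeriv.zero (d : ℕ) : HasFormalDeriv q S d 0 0 := by
  induction d with
  | zero => exact .base (zero_mem _)
  | succ d ih => exact .succ ih

theorem HasFormalDeriv.smul (c : k) {d : ℕ} {v : M} {δ : Y →₀ M} (h : HasFormalDeriv q S d v δ) :
    HasFormalDeriv q S d (c • v) (c • δ) := by
  induction h with
  | base hs => simpa using HasFormalDeriv.base (q := q) (S.smul_mem c hs)
  | cons y _ ih =>
    convert HasFormalDeriv.cons y ih using 1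
    · rw [lie_smul]
    · ext x; simp
  | add _ _ ih ih' => rw [smul_add, smul_add]; exact .add ih ih'
  | succ _ ih => exact .succ ih

variable (q S) in
/-- The vectors of degree less than `d` in the operators `q y`, relative to `S`. -/
def degreeFiltration : ℕ → Submodule k M
  | 0 => ⊥
  | d + 1 =>
    { carrier := {v | ∃ δ, HasFormalDeriv q S d v δ}
      add_mem' := fun ⟨_, h⟩ ⟨_, h'⟩ => ⟨_, h.add h'⟩
      zero_mem' := ⟨0, .zero d⟩
      smul_mem' := fun c _ ⟨_, h⟩ => ⟨_, h.smul c⟩ }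

theorem HasFormalDeriv.mem {d : ℕ} {v : M} {δ : Y →₀ M} (h : HasFormalDeriv q S d v δ) :
    v ∈ degreeFiltration q S (d + 1) := ⟨δ, h⟩

theorem eq_zero_of_mem_degreeFiltration_zero {v : M} (h : v ∈ degreeFiltration q S 0) : v = 0 := h

theorem degreeFiltration_le_succ (d : ℕ) : degreeFiltration q S d ≤ degreeFiltration q S (d + 1) := by
  cases d with
  | zero => exact bot_le
  | succ d => rintro v ⟨δ, h⟩; exact ⟨δ, h.succ⟩

theorem degreeFiltration_mono : Monotone (degreeFiltration q S) :=
  monotone_nat_of_le_succ degreeFiltration_le_succ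

theorem letter_lie_mem_degreeFiltration (y : Y) {d : ℕ} {v : M}
    (hv : v ∈ degreeFiltration q S d) : ⁅q y, v⁆ ∈ degreeFiltration q S (d + 1) := by
  cases d with
  | zero => rw [eq_zero_of_mem_degreeFiltration_zero hv, lie_zero]; exact zero_mem _
  | succ d => obtain ⟨δ, h⟩ := hv; exact (h.cons y).mem

omit [LieAlgebra k g] [LieModule k g M] in
theorem HasFormalDeriv.mem_of_eq_zero {d : ℕ} {v : M} {δ : Y →₀ M} (h : HasFormalDeriv q S d v δ)
    (hd : d = 0) : v ∈ S := by
  induction h with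
  | base hs => exact hs
  | cons => omega
  | add _ _ ih ih' => exact add_mem (ih hd) (ih' hd)
  | succ => omega

theorem mem_degreeFiltration_one {v : M} : v ∈ degreeFiltration q S 1 ↔ v ∈ S :=
  ⟨fun ⟨_, h⟩ => h.mem_of_eq_zero rfl, fun h => ⟨0, .base h⟩⟩

theorem HasFormalDeriv.deriv_mem {d : ℕ} {v : M} {δ : Y →₀ M} (h : HasFormalDeriv q S d v δ)
    (y : Y) : δ y ∈ degreeFiltration q S d := by
  classical
  induction h with
  | base hs => exact zero_mem _
  | @cons d v δ x h ih =>
    rw [Finsupp.add_apply, Finsupp.mapRange_apply]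
    refine add_mem ?_ (letter_lie_mem_degreeFiltration x ih)
    rw [Finsupp.single_apply]
    split_ifs
    · exact h.mem
    · exact zero_mem _
  | add _ _ ih ih' => exact add_mem ih ih'
  | succ _ ih => exact degreeFiltration_le_succ _ ih

/-- Moving `z` to the right through a word replaces one letter by its bracket with `z`, which costs
no more degree than the letter did; at the end `z` is absorbed by `S`. -/
theorem lie_mem_degreeFiltration {z : g} (hS : ∀ s ∈ S, ⁅z, s⁆ ∈ S)
    (hz : ∀ d y, ∀ v ∈ degreeFiltration q S d, ⁅⁅z, q y⁆, v⁆ ∈ degreeFiltration q S (d + 1))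
    {d : ℕ} {v : M} (hv : v ∈ degreeFiltration q S d) : ⁅z, v⁆ ∈ degreeFiltration q S d := by
  cases d with
  | zero => rw [eq_zero_of_mem_degreeFiltration_zero hv, lie_zero]; exact zero_mem _
  | succ d =>
    obtain ⟨δ, h⟩ := hv
    induction h with
    | base hs => exact mem_degreeFiltration_one.mpr (hS _ hs)
    | cons y h ih =>
      rw [leibniz_lie]
      exact add_mem (hz _ y _ h.mem) (letter_lie_mem_degreeFiltration y ih)
    | add _ _ ih ih' => rw [lie_add]; exact add_mem ih ih'
    | succ _ ih => exact degreeFiltration_le_succ _ ih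

theorem lie_mem_degreeFiltration_of_mem {A : Set g} (hS : ∀ z ∈ A, ∀ s ∈ S, ⁅z, s⁆ ∈ S)
    (hA : ∀ z ∈ A, ∀ y, ∃ c : k, ∃ z' ∈ A, ⁅z, q y⁆ = c • z') {z : g} (hz : z ∈ A)
    {d : ℕ} {v : M} (hv : v ∈ degreeFiltration q S d) : ⁅z, v⁆ ∈ degreeFiltration q S d := by
  cases d with
  | zero => rw [eq_zero_of_mem_degreeFiltration_zero hv, lie_zero]; exact zero_mem _
  | succ d =>
    obtain ⟨δ, h⟩ := hv
    induction h generalizing z with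
    | base hs => exact mem_degreeFiltration_one.mpr (hS z hz _ hs)
    | cons y h ih =>
      obtain ⟨c, z', hz', e⟩ := hA z hz y
      rw [leibniz_lie, e, smul_lie]
      exact add_mem (degreeFiltration_le_succ _ (Submodule.smul_mem _ c (ih hz')))
        (letter_lie_mem_degreeFiltration y (ih hz))
    | add _ _ ih ih' => rw [lie_add]; exact add_mem (ih hz) (ih' hz)
    | succ _ ih => exact degreeFiltration_le_succ _ (ih hz)

theorem lie_eq_smul_of_mem_degreeFiltration {z : g} {c : k} (hS : ∀ s ∈ S, ⁅z, s⁆ = c • s)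
    (hz : ∀ y, ⁅z, q y⁆ = 0) {d : ℕ} {v : M} (hv : v ∈ degreeFiltration q S d) :
    ⁅z, v⁆ = c • v := by
  cases d with
  | zero => rw [eq_zero_of_mem_degreeFiltration_zero hv, lie_zero, smul_zero]
  | succ d =>
    obtain ⟨δ, h⟩ := hv
    induction h with
    | base hs => exact hS _ hs
    | cons y h ih => rw [leibniz_lie, hz, zero_lie, zero_add, ih, lie_smul]
    | add _ _ ih ih' => rw [lie_add, ih, ih', smul_add]
    | succ _ ih => exact ih

/-- The inductive step shared by Euler's identity (`f = q`) and by the derivation formula (`f y =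
⁅z, q y⁆`); the last sum is the price of moving `f y` past `q x`. -/
theorem sum_lie_cons (f : Y → g) (x : Y) (v : M) (δ : Y →₀ M) :
    (Finsupp.single x v + δ.mapRange (fun u => ⁅q x, u⁆) (lie_zero (q x))).sum
        (fun y u => ⁅f y, u⁆) =
      ⁅f x, v⁆ + ⁅q x, δ.sum fun y u => ⁅f y, u⁆⁆ + δ.sum fun y u => ⁅⁅f y, q x⁆, u⁆ := by
  classical
  rw [Finsupp.sum_add_index' (fun y => lie_zero _) (fun y => lie_add _),
    Finsupp.sum_single_index (lie_zero _), Finsupp.sum_mapRange_index (fun y => lie_zero _),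
    add_assoc]
  congr 1
  rw [Finsupp.sum, Finsupp.sum, Finsupp.sum, lie_sum, ← Finset.sum_add_distrib]
  refine Finset.sum_congr rfl fun y _ => ?_
  rw [leibniz_lie, add_comm]

/-- Euler's identity for formal partial derivatives, up to terms of lower degree. -/
theorem HasFormalDeriv.euler
    (hq : ∀ x y d, ∀ v ∈ degreeFiltration q S d, ⁅⁅q y, q x⁆, v⁆ ∈ degreeFiltration q S (d + 1))
    {d : ℕ} {v : M} {δ : Y →₀ M} (h : HasFormalDeriv q S d v δ) :
    (δ.sum fun y u => ⁅q y, u⁆) - (d : k) • v ∈ degreeFiltration q S d := by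
  induction h with
  | base hs => simp
  | @cons d v δ x h ih =>
    rw [sum_lie_cons]
    have e : ⁅q x, v⁆ + ⁅q x, δ.sum fun y u => ⁅q y, u⁆⁆ + (δ.sum fun y u => ⁅⁅q y, q x⁆, u⁆) -
        ((d + 1 : ℕ) : k) • ⁅q x, v⁆ = ⁅q x, (δ.sum fun y u => ⁅q y, u⁆) - (d : k) • v⁆ +
          δ.sum fun y u => ⁅⁅q y, q x⁆, u⁆ := by
      rw [lie_sub, lie_smul]; push_cast; module
    rw [e]
    exact add_mem (letter_lie_mem_degreeFiltration x ih)
      (Submodule.sum_mem _ fun y _ => hq _ _ _ _ (h.deriv_mem y))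
  | add _ _ ih ih' =>
    rw [Finsupp.sum_add_index' (fun y => lie_zero _) (fun y => lie_add _), smul_add,
      add_sub_add_comm]
    exact add_mem ih ih'
  | @succ d v δ h ih =>
    have e : (δ.sum fun y u => ⁅q y, u⁆) - ((d + 1 : ℕ) : k) • v =
        (δ.sum fun y u => ⁅q y, u⁆) - (d : k) • v - v := by push_cast; module
    rw [e]
    exact sub_mem (degreeFiltration_le_succ _ ih) h.mem

/-- By Euler's identity `d • v` agrees with the sum of the `⁅q y, δ y⁆` up to lower degree, and `d`
is invertible. -/
theorem HasFormalDeriv.mem_of_lie_deriv_mem [CharZero k]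
    (hq : ∀ x y d, ∀ v ∈ degreeFiltration q S d, ⁅⁅q y, q x⁆, v⁆ ∈ degreeFiltration q S (d + 1))
    {d : ℕ} (hd : d ≠ 0) {v : M} {δ : Y →₀ M} (h : HasFormalDeriv q S d v δ)
    (hδ : ∀ y, ⁅q y, δ y⁆ ∈ degreeFiltration q S d) : v ∈ degreeFiltration q S d := by
  have h₁ : (d : k) • v ∈ degreeFiltration q S d := by
    rw [← sub_sub_self (δ.sum fun y u => ⁅q y, u⁆) ((d : k) • v)]
    exact sub_mem (Submodule.sum_mem _ fun y _ => hδ y) (h.euler hq)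
  exact (Submodule.smul_mem_iff _ (Nat.cast_ne_zero.mpr hd)).mp h₁

/-- An element acting on `S` as the scalar `c` acts as `c` plus a derivation, up to an error term
controlled by double brackets. -/
theorem HasFormalDeriv.lie_sub_smul_sub_sum_mem {z : g} {c : k} (hS : ∀ s ∈ S, ⁅z, s⁆ = c • s)
    {E : ℕ → Submodule k M} (hE : ∀ d, E d ≤ E (d + 1))
    (hqE : ∀ d y, ∀ v ∈ E d, ⁅q y, v⁆ ∈ E (d + 1))
    (hz : ∀ x y d, ∀ v ∈ degreeFiltration q S d, ⁅⁅⁅z, q y⁆, q x⁆, v⁆ ∈ E (d + 1))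
    {d : ℕ} {v : M} {δ : Y →₀ M} (h : HasFormalDeriv q S d v δ) :
    ⁅z, v⁆ - c • v - (δ.sum fun y u => ⁅⁅z, q y⁆, u⁆) ∈ E d := by
  induction h with
  | base hs => simp [hS _ hs]
  | @cons d v δ x h ih =>
    rw [sum_lie_cons]
    have e : ⁅z, ⁅q x, v⁆⁆ - c • ⁅q x, v⁆ - (⁅⁅z, q x⁆, v⁆ +
        ⁅q x, δ.sum fun y u => ⁅⁅z, q y⁆, u⁆⁆ + δ.sum fun y u => ⁅⁅⁅z, q y⁆, q x⁆, u⁆) =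
        ⁅q x, ⁅z, v⁆ - c • v - δ.sum fun y u => ⁅⁅z, q y⁆, u⁆⁆ -
          δ.sum fun y u => ⁅⁅⁅z, q y⁆, q x⁆, u⁆ := by
      rw [lie_sub, lie_sub, lie_smul, leibniz_lie z]; abel
    rw [e]
    exact sub_mem (hqE _ _ _ ih) (Submodule.sum_mem _ fun y _ => hz _ _ _ _ (h.deriv_mem y))
  | add _ _ ih ih' =>
    rw [Finsupp.sum_add_index' (fun y => lie_zero _) (fun y => lie_add _), smul_add, lie_add,
      add_sub_add_comm, add_sub_add_comm]
    exact add_mem ih ih'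
  | succ _ ih => exact hE _ ih

/-- A subspace meeting the filtration meets its first step, if intersections can be lowered. -/
theorem exists_mem_degreeFiltration_one (N : Submodule k M)
    (h : ∀ d ≠ 0, ∀ v ∈ N, v ∈ degreeFiltration q S (d + 1) →
      (∀ u ∈ N, u ∈ degreeFiltration q S d → u = 0) → v ∈ degreeFiltration q S d)
    (d : ℕ) {v : M} (hv : v ∈ N) (hvd : v ∈ degreeFiltration q S d) (hv0 : v ≠ 0) :
    ∃ u ∈ N, u ∈ S ∧ u ≠ 0 := by
  induction d generalizing v with
  | zero => exact absurd hvd hv0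
  | succ d ih =>
    by_cases hd : d = 0
    · subst hd
      exact ⟨v, hv, mem_degreeFiltration_one.mp hvd, hv0⟩
    · by_cases hu : ∃ u ∈ N, u ∈ degreeFiltration q S d ∧ u ≠ 0
      · obtain ⟨u, huN, hud, hu0⟩ := hu
        exact ih huN hud hu0
      · push Not at hu
        exact absurd (hu v hv (h d hd v hv hvd hu)) hv0

omit [LieAlgebra k g] [LieModule k g M] in
/-- A sum over letters with two types of each integer index, modulo a subspace containing
the terms of index different from `i`. -/
theorem sum_lie_sub_mem (E : Submodule k M) (f : ℤ × Bool → g) (δ : ℤ × Bool →₀ M) (i : ℤ)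
    (h : ∀ y, y.1 ≠ i → ⁅f y, δ y⁆ ∈ E) :
    (δ.sum fun y u => ⁅f y, u⁆) - (⁅f (i, false), δ (i, false)⁆ + ⁅f (i, true), δ (i, true)⁆) ∈
      E := by
  classical
  rw [Finsupp.sum_of_support_subset δ
    (s := δ.support ∪ {(i, false), (i, true)}) Finset.subset_union_left _
    (fun y _ => lie_zero _), ← Finset.sum_sdiff (s₁ := {(i, false), (i, true)})
    Finset.subset_union_right, Finset.sum_pair (by simp), add_sub_cancel_right]
  refine Submodule.sum_mem _ fun y hy => h y fun hyi => ?_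
  obtain ⟨j, c⟩ := y
  subst hyi
  cases c <;> simp at hy

/-- Induction on the index of a letter, starting below the support of `δ`. -/
theorem forall_deriv_mem_of_forall_lt (E : Submodule k M) (δ : ℤ × Bool →₀ M) (b : ℤ)
    (h : ∀ i < b, (∀ y : ℤ × Bool, y.1 < i → δ y ∈ E) → δ (i, false) ∈ E ∧ δ (i, true) ∈ E)
    (y : ℤ × Bool) (hy : y.1 < b) : δ y ∈ E := by
  classical
  -- Finite support gives the induction over ℤ a starting point: `δ` vanishes below `B`.
  obtain ⟨B, hB⟩ : ∃ B : ℤ, ∀ y ∈ δ.support, B ≤ y.1 := by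
    obtain ⟨B, hB⟩ := (δ.support.image Prod.fst).bddBelow
    exact ⟨B, fun y hy => hB (Finset.mem_coe.mpr (Finset.mem_image_of_mem _ hy))⟩
  have key : ∀ j : ℕ, ∀ y : ℤ × Bool, y.1 < b → y.1 < B + j → δ y ∈ E := by
    intro j
    induction j with
    | zero =>
      intro y _ hyB
      rw [Finsupp.notMem_support_iff.mp fun hy => absurd (hB y hy) (by omega)]
      exact zero_mem _
    | succ j ih =>
      rintro ⟨i, c⟩ hib hij
      dsimp only at hib hij
      have := h i hib fun y hy => ih y (by omega) (by push_cast at hij; omega)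
      cases c
      · exact this.1
      · exact this.2
  exact key (y.1 - B + 1).toNat y hy (by omega)

end DegreeFiltration

/-! ### Irreducibility when ψ is nonzero on I and J at index m+n-1. -/

noncomputable section WhittakerIrreducible

namespace PlanarGalilean

/-- The generators `L_i` and `H_i`. -/
def lhLetter : ℤ × Bool → PlanarGalilean
  | (i, false) => L i
  | (i, true) => H i

/-- The generators `I_i` and `J_i`. -/
def ijLetter : ℤ × Bool → PlanarGalilean
  | (i, false) => I i
  | (i, true) => J i

theorem lie_L_L (i j : ℤ) : ⁅L i, L j⁆ =
    ((j : ℂ) - i) • L (i + j) + (if i + j = 0 then ((i : ℂ) ^ 3 - i) / 12 else 0) • c₁ :=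
  lie_basis _ _

theorem lie_L_H (i j : ℤ) : ⁅L i, H j⁆ =
    (j : ℂ) • H (i + j) + (if i + j = 0 then (i : ℂ) ^ 2 else 0) • c₂ :=
  lie_basis _ _

theorem lie_H_H (i j : ℤ) : ⁅H i, H j⁆ = (if i + j = 0 then (i : ℂ) else 0) • c₃ := lie_basis _ _

theorem lie_L_I (i j : ℤ) : ⁅L i, I j⁆ = ((j : ℂ) - i) • I (i + j) := lie_basis _ _

theorem lie_L_J (i j : ℤ) : ⁅L i, J j⁆ = ((j : ℂ) - i) • J (i + j) := lie_basis _ _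

theorem lie_H_I (i j : ℤ) : ⁅H i, I j⁆ = I (i + j) := lie_basis _ _

theorem lie_H_J (i j : ℤ) : ⁅H i, J j⁆ = -J (i + j) := lie_basis _ _

theorem lie_ijLetter_ijLetter (x y : ℤ × Bool) : ⁅ijLetter x, ijLetter y⁆ = 0 := by
  obtain ⟨i, _ | _⟩ := x <;> obtain ⟨j, _ | _⟩ := y <;> exact lie_basis _ _

theorem exists_lie_ijLetter_lhLetter (y x : ℤ × Bool) :
    ∃ c : ℂ, ⁅ijLetter y, lhLetter x⁆ = c • ijLetter (x.1 + y.1, y.2) := by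
  obtain ⟨i, _ | _⟩ := y <;> obtain ⟨j, _ | _⟩ := x <;> rw [← lie_skew] <;>
    simp only [ijLetter, lhLetter, lie_L_I, lie_L_J, lie_H_I, lie_H_J, neg_neg]
  · exact ⟨_, (neg_smul _ _).symm⟩
  · exact ⟨_, (neg_one_smul ℂ _).symm⟩
  · exact ⟨_, (neg_smul _ _).symm⟩
  · exact ⟨_, (one_smul ℂ _).symm⟩

theorem exists_lie_lhLetter_ijLetter (x y : ℤ × Bool) :
    ∃ c : ℂ, ⁅lhLetter x, ijLetter y⁆ = c • ijLetter (x.1 + y.1, y.2) := by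
  obtain ⟨c, hc⟩ := exists_lie_ijLetter_lhLetter y x
  exact ⟨-c, by rw [← lie_skew, hc, neg_smul]⟩

/-- The central generators. -/
def centralSet : Set PlanarGalilean := {c₁, c₂, c₃}

theorem lie_of_mem_centralSet {z : PlanarGalilean} (hz : z ∈ centralSet) (x : PlanarGalilean) :
    ⁅z, x⁆ = 0 := by
  induction basis.mem_span x using Submodule.span_induction with
  | zero => exact lie_zero z
  | add x y _ _ hx hy => rw [lie_add, hx, hy, add_zero]
  | smul c x _ hx => rw [lie_smul, hx, smul_zero]
  | mem x hx =>
    obtain ⟨i, rfl⟩ := hx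
    rcases hz with rfl | rfl | rfl <;> cases i <;> exact lie_basis _ _

theorem lie_lhLetter_lhLetter_mem (x y : ℤ × Bool) :
    ⁅lhLetter x, lhLetter y⁆ ∈ Submodule.span ℂ (Set.range lhLetter ∪ centralSet) := by
  have hL (i : ℤ) : L i ∈ Submodule.span ℂ (Set.range lhLetter ∪ centralSet) :=
    Submodule.subset_span (Or.inl ⟨(i, false), rfl⟩)
  have hH (i : ℤ) : H i ∈ Submodule.span ℂ (Set.range lhLetter ∪ centralSet) :=
    Submodule.subset_span (Or.inl ⟨(i, true), rfl⟩)
  have hc {z : PlanarGalilean} (hz : z ∈ centralSet) :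
      z ∈ Submodule.span ℂ (Set.range lhLetter ∪ centralSet) := Submodule.subset_span (Or.inr hz)
  obtain ⟨i, _ | _⟩ := x <;> obtain ⟨j, _ | _⟩ := y <;> simp only [lhLetter]
  · rw [lie_L_L]
    exact add_mem (Submodule.smul_mem _ _ (hL _))
      (Submodule.smul_mem _ _ (hc (by simp [centralSet])))
  · rw [lie_L_H]
    exact add_mem (Submodule.smul_mem _ _ (hH _))
      (Submodule.smul_mem _ _ (hc (by simp [centralSet])))
  · rw [← lie_skew, lie_L_H]
    exact neg_mem (add_mem (Submodule.smul_mem _ _ (hH _))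
      (Submodule.smul_mem _ _ (hc (by simp [centralSet]))))
  · rw [lie_H_H]
    exact Submodule.smul_mem _ _ (hc (by simp [centralSet]))

/-- The integer m+n-1-2i is odd. It is the coefficient in [L_i, I_{m+n-1-i}], and this is the only
use of the parity assumption. -/
theorem sub_ne_zero_of_parity {m n : ℕ} (hmn : Even m ↔ Even n) (i : ℤ) :
    (((m : ℤ) + n - 1 - i : ℤ) : ℂ) - (i : ℂ) ≠ 0 := by
  rw [← Int.cast_sub, Int.cast_ne_zero]
  simp only [Nat.even_iff] at hmn
  omega

section

variable {m n : ℕ} (χ : PlanarGalilean →ₗ[ℂ] ℂ) {M : Type*} [AddCommGroup M] [Module ℂ M]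
  [LieRingModule PlanarGalilean M] [LieModule ℂ PlanarGalilean M]

variable (m n) in
/-- A vector on which the basis elements of `𝒢^{(m,n)}` act by the values of `χ`. -/
def IsWhittakerVector (w : M) : Prop := ∀ k : Gen, k.Mem m n → ⁅basis k, w⁆ = χ (basis k) • w

variable {χ} {w : M}

omit [LieModule ℂ PlanarGalilean M] in
theorem IsWhittakerVector.lie_lhLetter (hw : IsWhittakerVector m n χ w) {x : ℤ × Bool}
    (hx : (m : ℤ) ≤ x.1) : ⁅lhLetter x, w⁆ = χ (lhLetter x) • w := by
  obtain ⟨i, _ | _⟩ := x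
  · exact hw (.L i) hx
  · exact hw (.H i) hx

omit [LieModule ℂ PlanarGalilean M] in
theorem IsWhittakerVector.lie_ijLetter (hw : IsWhittakerVector m n χ w) {x : ℤ × Bool}
    (hx : (n : ℤ) ≤ x.1) : ⁅ijLetter x, w⁆ = χ (ijLetter x) • w := by
  obtain ⟨i, _ | _⟩ := x
  · exact hw (.I i) hx
  · exact hw (.J i) hx

omit [LieModule ℂ PlanarGalilean M] in
theorem IsWhittakerVector.lie_central (hw : IsWhittakerVector m n χ w) {z : PlanarGalilean}
    (hz : z ∈ centralSet) : ⁅z, w⁆ = χ z • w := by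
  rcases hz with rfl | rfl | rfl
  · exact hw .c₁ trivial
  · exact hw .c₂ trivial
  · exact hw .c₃ trivial

variable (w) in
/-- Combinations of words in the `I_i` and `J_i` applied to `w`, filtered by degree. -/
abbrev ijFiltration : ℕ → Submodule ℂ M :=
  degreeFiltration ijLetter (Submodule.span ℂ {w})

variable (w) in
/-- Combinations of words in the `I_i` and `J_i` applied to `w`. -/
def ijSpan : Submodule ℂ M := ⨆ d, ijFiltration w d

theorem mem_ijSpan {v : M} : v ∈ ijSpan w ↔ ∃ d, v ∈ ijFiltration w d :=
  Submodule.mem_iSup_of_directed _ (degreeFiltration_mono).directed_le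

theorem lie_eq_smul_of_mem_span {z : PlanarGalilean} {c : ℂ} (h : ⁅z, w⁆ = c • w) :
    ∀ s ∈ Submodule.span ℂ {w}, ⁅z, s⁆ = c • s := by
  intro s hs
  obtain ⟨r, rfl⟩ := Submodule.mem_span_singleton.mp hs
  rw [lie_smul, h, smul_comm]

theorem IsWhittakerVector.lie_ijLetter_of_mem (hw : IsWhittakerVector m n χ w) {x : ℤ × Bool}
    (hx : (n : ℤ) ≤ x.1) {v : M} (hv : v ∈ ijSpan w) :
    ⁅ijLetter x, v⁆ = χ (ijLetter x) • v := by
  obtain ⟨d, hd⟩ := mem_ijSpan.mp hv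
  exact lie_eq_smul_of_mem_degreeFiltration (lie_eq_smul_of_mem_span (hw.lie_ijLetter hx))
    (lie_ijLetter_ijLetter x) hd

theorem IsWhittakerVector.lie_central_of_mem (hw : IsWhittakerVector m n χ w) {z : PlanarGalilean}
    (hz : z ∈ centralSet) {v : M} (hv : v ∈ ijSpan w) : ⁅z, v⁆ = χ z • v := by
  obtain ⟨d, hd⟩ := mem_ijSpan.mp hv
  exact lie_eq_smul_of_mem_degreeFiltration (lie_eq_smul_of_mem_span (hw.lie_central hz))
    (fun y => lie_of_mem_centralSet hz _) hd

theorem lie_ijLetter_mem_ijSpan (x : ℤ × Bool) {v : M} (hv : v ∈ ijSpan w) :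
    ⁅ijLetter x, v⁆ ∈ ijSpan w := by
  obtain ⟨d, hd⟩ := mem_ijSpan.mp hv
  exact mem_ijSpan.mpr ⟨_, letter_lie_mem_degreeFiltration x hd⟩

theorem IsWhittakerVector.lie_lhLetter_mem_ijSpan (hw : IsWhittakerVector m n χ w) {x : ℤ × Bool}
    (hx : (m : ℤ) ≤ x.1) {v : M} (hv : v ∈ ijSpan w) : ⁅lhLetter x, v⁆ ∈ ijSpan w := by
  obtain ⟨d, hd⟩ := mem_ijSpan.mp hv
  refine mem_ijSpan.mpr ⟨d, lie_mem_degreeFiltration (fun s hs => ?_) (fun e y u hu => ?_) hd⟩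
  · rw [lie_eq_smul_of_mem_span (hw.lie_lhLetter hx) s hs]
    exact Submodule.smul_mem _ _ hs
  · obtain ⟨c, hc⟩ := exists_lie_lhLetter_ijLetter x y
    rw [hc, smul_lie]
    exact Submodule.smul_mem _ _ (letter_lie_mem_degreeFiltration _ hu)

/-- `L_i` and `H_i` with `i ≥ m` act on words in the `I_j` and `J_j` by derivations. -/
theorem IsWhittakerVector.lie_lhLetter_eq (hw : IsWhittakerVector m n χ w) {x : ℤ × Bool}
    (hx : (m : ℤ) ≤ x.1) {d : ℕ} {v : M} {δ : ℤ × Bool →₀ M}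
    (h : HasFormalDeriv ijLetter (Submodule.span ℂ {w}) d v δ) :
    ⁅lhLetter x, v⁆ - χ (lhLetter x) • v = δ.sum fun y u => ⁅⁅lhLetter x, ijLetter y⁆, u⁆ := by
  -- There is no error term: the double brackets [[x, I or J], I or J] vanish.
  have := h.lie_sub_smul_sub_sum_mem (E := fun _ => ⊥)
    (lie_eq_smul_of_mem_span (hw.lie_lhLetter hx)) (fun _ => le_rfl)
    (fun d y v hv => by rw [(Submodule.mem_bot ℂ).mp hv, lie_zero]; exact zero_mem _)
    (fun y y' d v _ => by
      obtain ⟨c, hc⟩ := exists_lie_lhLetter_ijLetter x y'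
      rw [hc, smul_lie, lie_ijLetter_ijLetter, smul_zero, zero_lie]
      exact zero_mem _)
  exact sub_eq_zero.mp ((Submodule.mem_bot ℂ).mp this)

variable (w) in
/-- The filtration by degree in the `L_i` and `H_i`. -/
abbrev lhFiltration : ℕ → Submodule ℂ M :=
  degreeFiltration lhLetter (ijSpan w)

theorem lie_ijLetter_mem_lhFiltration (x : ℤ × Bool) {d : ℕ} {v : M} (hv : v ∈ lhFiltration w d) :
    ⁅ijLetter x, v⁆ ∈ lhFiltration w d := by
  refine lie_mem_degreeFiltration_of_mem (A := Set.range ijLetter) ?_ ?_ ⟨x, rfl⟩ hv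
  · rintro _ ⟨y, rfl⟩ s hs
    exact lie_ijLetter_mem_ijSpan y hs
  · rintro _ ⟨y, rfl⟩ y'
    obtain ⟨c, hc⟩ := exists_lie_ijLetter_lhLetter y y'
    exact ⟨c, _, ⟨_, rfl⟩, hc⟩

theorem IsWhittakerVector.lie_central_mem_lhFiltration (hw : IsWhittakerVector m n χ w)
    {z : PlanarGalilean} (hz : z ∈ centralSet) {d : ℕ} {v : M} (hv : v ∈ lhFiltration w d) :
    ⁅z, v⁆ ∈ lhFiltration w d := by
  rw [lie_eq_smul_of_mem_degreeFiltration (fun s hs => hw.lie_central_of_mem hz hs)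
    (fun y => lie_of_mem_centralSet hz _) hv]
  exact Submodule.smul_mem _ _ hv

theorem IsWhittakerVector.lie_lie_mem_lhFiltration (hw : IsWhittakerVector m n χ w)
    (x y : ℤ × Bool) {d : ℕ} {v : M} (hv : v ∈ lhFiltration w d) :
    ⁅⁅lhLetter x, lhLetter y⁆, v⁆ ∈ lhFiltration w (d + 1) := by
  have hz := lie_lhLetter_lhLetter_mem x y
  generalize ⁅lhLetter x, lhLetter y⁆ = z at hz ⊢
  induction hz using Submodule.span_induction with
  | mem z hz =>
    rcases hz with ⟨y, rfl⟩ | hz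
    · exact letter_lie_mem_degreeFiltration y hv
    · exact degreeFiltration_le_succ _ (hw.lie_central_mem_lhFiltration hz hv)
  | zero => rw [zero_lie]; exact zero_mem _
  | add a b _ _ ha hb => rw [add_lie]; exact add_mem ha hb
  | smul c a _ ha => rw [smul_lie]; exact Submodule.smul_mem _ _ ha

theorem IsWhittakerVector.lie_lhLetter_mem_lhFiltration (hw : IsWhittakerVector m n χ w)
    {x : ℤ × Bool} (hx : (m : ℤ) ≤ x.1) {d : ℕ} {v : M} (hv : v ∈ lhFiltration w d) :
    ⁅lhLetter x, v⁆ ∈ lhFiltration w d :=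
  lie_mem_degreeFiltration (fun _ hs => hw.lie_lhLetter_mem_ijSpan hx hs)
    (fun _ y _ hu => hw.lie_lie_mem_lhFiltration x y hu) hv

/-- `I_i` and `J_i` with `i ≥ n` act by derivations with respect to the `L_j` and `H_j`, up to
terms of lower degree. -/
theorem IsWhittakerVector.lie_ijLetter_sub_mem (hw : IsWhittakerVector m n χ w) {x : ℤ × Bool}
    (hx : (n : ℤ) ≤ x.1) {d : ℕ} {v : M} {δ : ℤ × Bool →₀ M}
    (h : HasFormalDeriv lhLetter (ijSpan w) d v δ) :
    ⁅ijLetter x, v⁆ - χ (ijLetter x) • v - (δ.sum fun y u => ⁅⁅ijLetter x, lhLetter y⁆, u⁆) ∈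
      lhFiltration w (d - 1) := by
  -- The double brackets are again multiples of I or J, which preserve degree, so the error is one
  -- step below the derivative terms. At `d = 0` the truncated index still gives the zero subspace.
  refine h.lie_sub_smul_sub_sum_mem (E := fun d => lhFiltration w (d - 1))
    (fun s hs => hw.lie_ijLetter_of_mem hx hs)
    (fun d => degreeFiltration_mono (by omega)) (fun d y v hv => ?_) (fun y y' d v hv => ?_)
  · cases d with
    | zero => rw [eq_zero_of_mem_degreeFiltration_zero hv, lie_zero]; exact zero_mem _
    | succ d => exact letter_lie_mem_degreeFiltration y hv
  · obtain ⟨c, hc⟩ := exists_lie_ijLetter_lhLetter x y'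
    obtain ⟨c', hc'⟩ := exists_lie_ijLetter_lhLetter (y'.1 + x.1, x.2) y
    rw [hc, smul_lie, hc', smul_lie, smul_lie]
    exact Submodule.smul_mem _ _ (Submodule.smul_mem _ _ (lie_ijLetter_mem_lhFiltration _ hv))

theorem sum_lie_mem_lhFiltration (x : ℤ × Bool) {d : ℕ} {v : M} {δ : ℤ × Bool →₀ M}
    (h : HasFormalDeriv lhLetter (ijSpan w) d v δ) :
    (δ.sum fun y u => ⁅⁅ijLetter x, lhLetter y⁆, u⁆) ∈ lhFiltration w d := by
  refine Submodule.sum_mem _ fun y _ => ?_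
  obtain ⟨c, hc⟩ := exists_lie_ijLetter_lhLetter x y
  dsimp only
  rw [hc, smul_lie]
  exact Submodule.smul_mem _ _ (lie_ijLetter_mem_lhFiltration _ (h.deriv_mem y))

theorem IsWhittakerVector.lie_ijLetter_sub_smul_mem (hw : IsWhittakerVector m n χ w) {x : ℤ × Bool}
    (hx : (n : ℤ) ≤ x.1) {d : ℕ} {v : M} (hv : v ∈ lhFiltration w d) :
    ⁅ijLetter x, v⁆ - χ (ijLetter x) • v ∈ lhFiltration w (d - 1) := by
  cases d with
  | zero =>
    rw [eq_zero_of_mem_degreeFiltration_zero hv, lie_zero, smul_zero, sub_zero]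
    exact zero_mem _
  | succ d =>
    obtain ⟨δ, h⟩ := hv
    rw [← sub_add_cancel (⁅ijLetter x, v⁆ - χ (ijLetter x) • v)
      (δ.sum fun y u => ⁅⁅ijLetter x, lhLetter y⁆, u⁆)]
    exact add_mem (degreeFiltration_mono (by omega) (hw.lie_ijLetter_sub_mem hx h))
      (sum_lie_mem_lhFiltration x h)

variable (hχ : ∀ x : ℤ × Bool, (m : ℤ) + n ≤ x.1 → χ (ijLetter x) = 0)

include hχ in
/-- A submodule meeting the degree filtration only in degree `≥ d` cannot meet it in degree `d`,
unless `d = 0`: the case of words in the `L_i` and `H_i`. -/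
theorem IsWhittakerVector.mem_lhFiltration_of_forall (hm : 0 < m) (hmn : Even m ↔ Even n)
    (hI : χ (I ((m : ℤ) + n - 1)) ≠ 0) (hJ : χ (J ((m : ℤ) + n - 1)) ≠ 0)
    (hw : IsWhittakerVector m n χ w) (N : LieSubmodule ℂ PlanarGalilean M) (d : ℕ) (hd : d ≠ 0)
    (v : M) (hv : v ∈ N) (hvd : v ∈ lhFiltration w (d + 1))
    (hN : ∀ u ∈ N, u ∈ lhFiltration w d → u = 0) : v ∈ lhFiltration w d := by
  obtain ⟨δ, h⟩ := hvd
  -- Subtracting its scalar from I_x or J_x sends `v` to an element of `N` of lower degree, hence to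
  -- 0; only the derivative terms remain.
  have hsum (x : ℤ × Bool) (hx : (n : ℤ) ≤ x.1) :
      (δ.sum fun y u => ⁅⁅ijLetter x, lhLetter y⁆, u⁆) ∈ lhFiltration w (d - 1) := by
    have h₀ : ⁅ijLetter x, v⁆ - χ (ijLetter x) • v = 0 :=
      hN _ (sub_mem (N.lie_mem hv) (N.smul_mem _ hv)) (hw.lie_ijLetter_sub_smul_mem hx h.mem)
    have := hw.lie_ijLetter_sub_mem hx h
    rwa [h₀, zero_sub, neg_mem_iff] at this
  have hδ : ∀ y : ℤ × Bool, y.1 < m → δ y ∈ lhFiltration w (d - 1) := by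
    refine forall_deriv_mem_of_forall_lt _ δ m fun i hi ih => ?_
    -- The index m+n-1-i is at least n because i < m, and it sends letters of index i to I or J at
    -- m+n-1. Smaller letters drop out by the induction, larger ones because `χ` vanishes from m+n
    -- on.
    have hpair (c : Bool) : ⁅⁅ijLetter ((m : ℤ) + n - 1 - i, c), lhLetter (i, false)⁆,
        δ (i, false)⁆ + ⁅⁅ijLetter ((m : ℤ) + n - 1 - i, c), lhLetter (i, true)⁆, δ (i, true)⁆ ∈
        lhFiltration w (d - 1) := by
      refine (Submodule.sub_mem_iff_right _ (hsum ((m : ℤ) + n - 1 - i, c) (by dsimp only; omega))).mp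
        (sum_lie_sub_mem _ (fun y => ⁅ijLetter ((m : ℤ) + n - 1 - i, c), lhLetter y⁆) δ i
          fun y hy => ?_)
      obtain ⟨r, hr⟩ := exists_lie_ijLetter_lhLetter ((m : ℤ) + n - 1 - i, c) y
      rw [hr, smul_lie]
      refine Submodule.smul_mem _ _ ?_
      rcases lt_or_gt_of_ne hy with hy | hy
      · exact lie_ijLetter_mem_lhFiltration _ (ih y hy)
      · have := hw.lie_ijLetter_sub_smul_mem (x := (y.1 + ((m : ℤ) + n - 1 - i), c))
          (by dsimp only; omega) (h.deriv_mem y)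
        rwa [hχ _ (by dsimp only; omega), zero_smul, sub_zero] at this
    have hIe (e : M) (he : e ∈ lhFiltration w d) :
        ⁅I ((m : ℤ) + n - 1), e⁆ - χ (I ((m : ℤ) + n - 1)) • e ∈ lhFiltration w (d - 1) :=
      hw.lie_ijLetter_sub_smul_mem (x := ((m : ℤ) + n - 1, false)) (by dsimp only; omega) he
    have hJe (e : M) (he : e ∈ lhFiltration w d) :
        ⁅J ((m : ℤ) + n - 1), e⁆ - χ (J ((m : ℤ) + n - 1)) • e ∈ lhFiltration w (d - 1) :=
      hw.lie_ijLetter_sub_smul_mem (x := ((m : ℤ) + n - 1, true)) (by dsimp only; omega) he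
    have h₁ := hpair false
    have h₂ := hpair true
    have hp : i + ((m : ℤ) + n - 1 - i) = (m : ℤ) + n - 1 := by omega
    simp only [ijLetter, lhLetter] at h₁ h₂
    rw [← lie_skew (I _) (L i), ← lie_skew (I _) (H i), lie_L_I, lie_H_I, hp, neg_lie, neg_lie,
      smul_lie] at h₁
    rw [← lie_skew (J _) (L i), ← lie_skew (J _) (H i), lie_L_J, lie_H_J, hp, neg_lie, neg_neg,
      smul_lie] at h₂
    have ht := sub_ne_zero_of_parity hmn i
    set t : ℂ := (((m : ℤ) + n - 1 - i : ℤ) : ℂ) - (i : ℂ)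
    set a := χ (I ((m : ℤ) + n - 1))
    set b := χ (J ((m : ℤ) + n - 1))
    set e₁ := δ (i, false)
    set e₂ := δ (i, true)
    -- H acts on I and J with opposite signs, so I gives `t • e₁ + e₂` and J gives `t • e₁ - e₂`;
    -- together they separate `e₁` and `e₂`.
    have k₁ : t • e₁ + e₂ ∈ lhFiltration w (d - 1) := by
      rw [← Submodule.smul_mem_iff _ hI]
      have := add_mem (add_mem (Submodule.smul_mem _ t (hIe e₁ (h.deriv_mem _)))
        (hIe e₂ (h.deriv_mem _))) h₁
      rw [← neg_mem_iff]
      convert this using 1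
      module
    have k₂ : t • e₁ - e₂ ∈ lhFiltration w (d - 1) := by
      rw [← Submodule.smul_mem_iff _ hJ]
      have := add_mem (sub_mem (Submodule.smul_mem _ t (hJe e₁ (h.deriv_mem _)))
        (hJe e₂ (h.deriv_mem _))) h₂
      rw [← neg_mem_iff]
      convert this using 1
      module
    constructor
    · rw [← Submodule.smul_mem_iff _ (mul_ne_zero two_ne_zero ht)]
      convert add_mem k₁ k₂ using 1
      module
    · rw [← Submodule.smul_mem_iff _ (two_ne_zero (α := ℂ))]
      convert sub_mem k₁ k₂ using 1
      module
  refine h.mem_of_lie_deriv_mem (fun x y d v hv => hw.lie_lie_mem_lhFiltration y x hv) hd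
    fun y => ?_
  -- For index below m the derivative has dropped one degree; for index at least m the letter itself
  -- preserves degree.
  by_cases hy : y.1 < m
  · have := letter_lie_mem_degreeFiltration y (hδ y hy)
    rwa [Nat.sub_add_cancel (Nat.pos_of_ne_zero hd)] at this
  · exact hw.lie_lhLetter_mem_lhFiltration (not_lt.mp hy) (h.deriv_mem y)

include hχ in
/-- A submodule meeting the degree filtration only in degree `≥ d` cannot meet it in degree `d`,
unless `d = 0`: the case of words in the `I_i` and `J_i`. -/
theorem IsWhittakerVector.mem_ijFiltration_of_forall (hm : 0 < m) (hmn : Even m ↔ Even n)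
    (hI : χ (I ((m : ℤ) + n - 1)) ≠ 0) (hJ : χ (J ((m : ℤ) + n - 1)) ≠ 0)
    (hw : IsWhittakerVector m n χ w) (N : LieSubmodule ℂ PlanarGalilean M) (d : ℕ) (hd : d ≠ 0)
    (v : M) (hv : v ∈ N) (hvd : v ∈ ijFiltration w (d + 1))
    (hN : ∀ u ∈ N, u ∈ ijFiltration w d → u = 0) : v ∈ ijFiltration w d := by
  obtain ⟨δ, h⟩ := hvd
  have hδS (y : ℤ × Bool) : δ y ∈ ijSpan w := mem_ijSpan.mpr ⟨d, h.deriv_mem y⟩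
  have hδ : ∀ y : ℤ × Bool, y.1 < n → δ y ∈ (⊥ : Submodule ℂ M) := by
    refine forall_deriv_mem_of_forall_lt _ δ n fun i hi ih => ?_
    -- Here i < n makes m+n-1-i at least m, so L and H at this index act by exact derivations. The
    -- terms of index different from i vanish outright, leaving an element of `N`.
    have hpair (c : Bool) : ⁅⁅lhLetter ((m : ℤ) + n - 1 - i, c), ijLetter (i, false)⁆,
        δ (i, false)⁆ + ⁅⁅lhLetter ((m : ℤ) + n - 1 - i, c), ijLetter (i, true)⁆, δ (i, true)⁆ ∈
        N := by
      have hs := sum_lie_sub_mem ⊥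
        (fun y => ⁅lhLetter ((m : ℤ) + n - 1 - i, c), ijLetter y⁆) δ i fun y hy => by
          obtain ⟨r, hr⟩ := exists_lie_lhLetter_ijLetter ((m : ℤ) + n - 1 - i, c) y
          rw [hr, smul_lie]
          refine Submodule.smul_mem _ _ ?_
          rcases lt_or_gt_of_ne hy with hy | hy
          · rw [(Submodule.mem_bot ℂ).mp (ih y hy), lie_zero]
            exact zero_mem _
          · rw [hw.lie_ijLetter_of_mem (by dsimp only; omega) (hδS y),
              hχ _ (by dsimp only; omega), zero_smul]
            exact zero_mem _
      rw [← sub_eq_zero.mp ((Submodule.mem_bot ℂ).mp hs),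
        ← hw.lie_lhLetter_eq (by dsimp only; omega) h]
      exact sub_mem (N.lie_mem hv) (N.smul_mem _ hv)
    have hIe (e : M) (he : e ∈ ijSpan w) :
        ⁅I ((m : ℤ) + n - 1), e⁆ = χ (I ((m : ℤ) + n - 1)) • e :=
      hw.lie_ijLetter_of_mem (x := ((m : ℤ) + n - 1, false)) (by dsimp only; omega) he
    have hJe (e : M) (he : e ∈ ijSpan w) :
        ⁅J ((m : ℤ) + n - 1), e⁆ = χ (J ((m : ℤ) + n - 1)) • e :=
      hw.lie_ijLetter_of_mem (x := ((m : ℤ) + n - 1, true)) (by dsimp only; omega) he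
    have h₁ := hpair false
    have h₂ := hpair true
    have hp : (m : ℤ) + n - 1 - i + i = (m : ℤ) + n - 1 := by omega
    simp only [ijLetter, lhLetter] at h₁ h₂
    rw [lie_L_I, lie_L_J, hp, smul_lie, smul_lie, hIe _ (hδS _), hJe _ (hδS _)] at h₁
    rw [lie_H_I, lie_H_J, hp, neg_lie, hIe _ (hδS _), hJe _ (hδS _)] at h₂
    have ht := sub_ne_zero_of_parity hmn i
    rw [← neg_ne_zero, neg_sub] at ht
    set t : ℂ := (i : ℂ) - (((m : ℤ) + n - 1 - i : ℤ) : ℂ)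
    have e₁ := h.deriv_mem (i, false)
    have e₂ := h.deriv_mem (i, true)
    -- Both combinations lie in `N` and have lower degree, so they are zero.
    have k₁ := hN _ h₁ (add_mem (Submodule.smul_mem _ _ (Submodule.smul_mem _ _ e₁))
      (Submodule.smul_mem _ _ (Submodule.smul_mem _ _ e₂)))
    have k₂ := hN _ h₂ (add_mem (Submodule.smul_mem _ _ e₁)
      (neg_mem (Submodule.smul_mem _ _ e₂)))
    rw [← smul_add, smul_eq_zero_iff_right ht] at k₁
    rw [Submodule.mem_bot, Submodule.mem_bot]
    constructor
    · rw [← smul_eq_zero_iff_right (mul_ne_zero two_ne_zero hI), ← add_zero (0 : M)]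
      nth_rewrite 1 [← k₁]
      rw [← k₂]
      module
    · rw [← smul_eq_zero_iff_right (mul_ne_zero two_ne_zero hJ), ← sub_zero (0 : M)]
      nth_rewrite 1 [← k₁]
      rw [← k₂]
      module
  refine h.mem_of_lie_deriv_mem (fun x y d v hv => by
    rw [lie_ijLetter_ijLetter, zero_lie]; exact zero_mem _) hd fun y => ?_
  by_cases hy : y.1 < n
  · rw [(Submodule.mem_bot ℂ).mp (hδ y hy), lie_zero]
    exact zero_mem _
  · rw [hw.lie_ijLetter_of_mem (not_lt.mp hy) (hδS y)]
    exact Submodule.smul_mem _ _ (h.deriv_mem y)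

/-- The union of the filtration is stable under all basis elements and contains `w`, which
generates. -/
theorem IsWhittakerVector.exists_mem_lhFiltration (hw : IsWhittakerVector m n χ w)
    (hgen : ∀ N : LieSubmodule ℂ PlanarGalilean M, w ∈ N → N = ⊤) (v : M) :
    ∃ d, v ∈ lhFiltration w d := by
  have hmem {v : M} : v ∈ ⨆ d, lhFiltration w d ↔ ∃ d, v ∈ lhFiltration w d :=
    Submodule.mem_iSup_of_directed _ (degreeFiltration_mono).directed_le
  let N : LieSubmodule ℂ PlanarGalilean M :=
    { (⨆ d, lhFiltration w d) with
      lie_mem := fun {x v} hv => by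
        obtain ⟨d, hd⟩ := hmem.mp hv
        change ⁅x, v⁆ ∈ ⨆ d, lhFiltration w d
        induction basis.mem_span x using Submodule.span_induction with
        | zero => rw [zero_lie]; exact zero_mem _
        | add x y _ _ hx hy => rw [add_lie]; exact add_mem hx hy
        | smul c x _ hx => rw [smul_lie]; exact Submodule.smul_mem _ _ hx
        | mem x hx =>
          obtain ⟨k, rfl⟩ := hx
          refine hmem.mpr ?_
          cases k with
          | L i => exact ⟨_, letter_lie_mem_degreeFiltration (i, false) hd⟩
          | H i => exact ⟨_, letter_lie_mem_degreeFiltration (i, true) hd⟩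
          | I i => exact ⟨_, lie_ijLetter_mem_lhFiltration (i, false) hd⟩
          | J i => exact ⟨_, lie_ijLetter_mem_lhFiltration (i, true) hd⟩
          | c₁ => exact ⟨_, hw.lie_central_mem_lhFiltration (Or.inl rfl) hd⟩
          | c₂ => exact ⟨_, hw.lie_central_mem_lhFiltration (Or.inr (Or.inl rfl)) hd⟩
          | c₃ => exact ⟨_, hw.lie_central_mem_lhFiltration (Or.inr (Or.inr rfl)) hd⟩ }
  have hN : N = ⊤ := by
    refine hgen N (hmem.mpr ⟨1, mem_degreeFiltration_one.mpr (mem_ijSpan.mpr ⟨1, ?_⟩)⟩)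
    exact mem_degreeFiltration_one.mpr (Submodule.mem_span_singleton_self w)
  have hv : v ∈ N := hN ▸ LieSubmodule.mem_top v
  exact hmem.mp hv

include hχ in
theorem IsWhittakerVector.isIrreducible (hm : 0 < m) (hmn : Even m ↔ Even n)
    (hI : χ (I ((m : ℤ) + n - 1)) ≠ 0) (hJ : χ (J ((m : ℤ) + n - 1)) ≠ 0)
    (hw : IsWhittakerVector m n χ w)
    (hgen : ∀ N : LieSubmodule ℂ PlanarGalilean M, w ∈ N → N = ⊤) (hw0 : w ≠ 0) :
    LieModule.IsIrreducible ℂ PlanarGalilean M := by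
  have : Nontrivial M := ⟨w, 0, hw0⟩
  refine LieModule.IsIrreducible.mk fun N hN => hgen N ?_
  rw [Ne, LieSubmodule.eq_bot_iff] at hN
  push Not at hN
  obtain ⟨v, hv, hv0⟩ := hN
  obtain ⟨d, hd⟩ := hw.exists_mem_lhFiltration hgen v
  -- The first descent removes L and H, the second removes I and J, leaving a nonzero multiple of
  -- `w` in `N`.
  obtain ⟨u, huN, huS, hu0⟩ := exists_mem_degreeFiltration_one N.toSubmodule
    (hw.mem_lhFiltration_of_forall hχ hm hmn hI hJ N) d hv hd hv0
  obtain ⟨e, he⟩ := mem_ijSpan.mp huS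
  obtain ⟨s, hsN, hsS, hs0⟩ := exists_mem_degreeFiltration_one N.toSubmodule
    (hw.mem_ijFiltration_of_forall hχ hm hmn hI hJ N) e huN he hu0
  obtain ⟨r, rfl⟩ := Submodule.mem_span_singleton.mp hsS
  have hr : r ≠ 0 := fun hr => hs0 (by rw [hr, zero_smul])
  exact (Submodule.smul_mem_iff _ hr).mp hsN

end

theorem isWhittakerVector_inducedGenerator {m n : ℕ} (ψ : WhittakerFunction m n) :
    IsWhittakerVector m n (WhittakerFunction.extend ψ 0)
      ((subalgebra m n).inducedGenerator ψ) := by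
  intro k hk
  rw [WhittakerFunction.extend_apply ψ 0 ⟨basis k, basis_mem_subalgebra hk⟩]
  exact (subalgebra m n).lie_inducedGenerator ψ ⟨basis k, basis_mem_subalgebra hk⟩

end PlanarGalilean

end WhittakerIrreducible

open PlanarGalilean in
theorem theorem3p8 (m n : ℕ) (hm : 0 < m) (hmn : Even m ↔ Even n) (ψ : WhittakerFunction m n) :
    LieModule.IsIrreducible ℂ PlanarGalilean (WhittakerModule ψ) ↔
      ψ ⟨I ((m : ℤ) + n - 1), I_mem_subalgebra (by omega)⟩ *
        ψ ⟨J ((m : ℤ) + n - 1), J_mem_subalgebra (by omega)⟩ ≠ 0 := by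
  rw [← WhittakerFunction.extend_apply ψ 0, ← WhittakerFunction.extend_apply ψ 0, mul_ne_zero_iff]
  constructor
  · intro h
    exact ⟨fun hI => not_isIrreducible_of_I ψ hm hI h, fun hJ => not_isIrreducible_of_J ψ hm hJ h⟩
  · rintro ⟨hI, hJ⟩
    refine (isWhittakerVector_inducedGenerator ψ).isIrreducible ?_ hm hmn hI hJ
      (fun N hN => (subalgebra m n).eq_top_of_inducedGenerator_mem ψ N hN)
      (inducedGenerator_ne_zero ψ)
    rintro ⟨i, _ | _⟩ hi
    · exact WhittakerFunction.extend_I ψ 0 hi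
    · exact WhittakerFunction.extend_J ψ 0 hi
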